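/- Let $n\ge 4$ be an integer, let $B\subset\mathbb{R}^{n+1}$ be the closed unit ball with Euclidean metric $dx^2$, and let $\partial B=S^n$ carry its standard surface measure. For a positive function $u\in C^\infty(B)$ put $g_u:=u^{\frac{8}{n-3}}dx^2$ and \[ L_4(u,u,u):=\Bigl(\tfrac{n-3}{4}u\Bigr)^3u^{\frac{16}{n-3}}\sigma_2^{g_u},\qquad B_3(u,u,u):=\Bigl(\tfrac{n-3}{4}u\Bigr)^3u^{\frac{12}{n-3}}H_2^{g_u}. \] Here, for a Riemannian metric $g$ on $B$, $P^g=\frac{1}{n-1}\bigl(\mathrm{Ric}^g-\frac{R^g}{2n}g\bigr)$ is the Schouten tensor, $\sigma_2^g=\frac12\bigl((\operatorname{tr}_gP^g)^2-|P^g|_g^2\bigr)$, and, when $\partial B$ is umbilic with respect to $g$ (as it is for $g=g_u$), $H_2^g=H^g\operatorname{tr}(P^g|_{T\partial B})+\frac n3(H^g)^3$ on $\partial B$, where the trace is taken with respect to the metric induced by $g$ and $H^g=\frac1n\operatorname{tr}(\nabla^g\eta^g)$ is the mean curvature with respect to the outward unit normal $\eta^g$. Define \[ \mathcal{E}_2(u):=\int_B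 u\,L_4(u,u,u)\,dx+\oint_{\partial B}u\,B_3(u,u,u). \] Let $\eta$ be the Euclidean outward unit normal along $\partial B$, and set \[ \sigma_1(u):=-\tfrac{n-3}{4}u\Delta u-\tfrac{n+1}{4}|\nabla u|^2,\qquad H(u):=\eta u+\tfrac{n-3}{4}u , \] \[ \mathcal{C}_1:=\bigl\{u\in C^\infty(B)\;\big|\;u>0\text{ and }\sigma_1(u)\ge 0\text{ on }B,\ H(u)>0\text{ on }\partial B\bigr\}. \] Then \[ \inf\Bigl\{\mathcal{E}_2(u)\;\Big|\;u\in\mathcal{C}_1,\ \oint_{\partial B}|u|^{\frac{4n}{n-3}}=1\Bigr\}>0 . \] -/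

import Mathlib

open MeasureTheory Metric
open scoped ContDiff Gradient Laplacian

noncomputable section

namespace SobolevTrace

/-- Euclidean `d`-space with its inner product and Lebesgue measure. -/
abbrev Euc (d : ℕ) : Type := EuclideanSpace ℝ (Fin d)

/-- The `i`-th coordinate derivative of `f` at `x`. -/
def pderiv {d : ℕ} (i : Fin d) (f : Euc d → ℝ) (x : Euc d) : ℝ :=
  fderiv ℝ f x (EuclideanSpace.single i 1)

section Riemannian

/-! ### Riemannian geometry of a metric `g`, given by its matrix in the standard coordinates -/

variable {d : ℕ} (g : Euc d → Matrix (Fin d) (Fin d) ℝ)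

/-- The Christoffel symbol `Γ^k_{ij}` of the Levi-Civita connection of `g`. -/
def christoffel (k i j : Fin d) (x : Euc d) : ℝ :=
  (1 / 2) * ∑ l, (g x)⁻¹ k l *
    (pderiv i (fun y => g y j l) x + pderiv j (fun y => g y i l) x - pderiv l (fun y => g y i j) x)

/-- The Ricci tensor `R_{ij}` of `g`, with the sign for which round spheres are positive. -/
def ricci (i j : Fin d) (x : Euc d) : ℝ :=
  ∑ k, (pderiv k (christoffel g k i j) x - pderiv j (christoffel g k i k) x) +
    ∑ k, ∑ l, (christoffel g k k l x * christoffel g l i j x -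
      christoffel g k j l x * christoffel g l i k x)

/-- The scalar curvature of `g`. -/
def scalarCurv (x : Euc d) : ℝ :=
  ∑ i, ∑ j, (g x)⁻¹ i j * ricci g i j x

/-- The Schouten tensor `P = (1/(n-1)) (Ric - (R/(2n)) g)` of a metric in dimension `d = n + 1`. -/
def schouten (i j : Fin d) (x : Euc d) : ℝ :=
  (1 / ((d : ℝ) - 2)) * (ricci g i j x - scalarCurv g x / (2 * ((d : ℝ) - 1)) * g x i j)

/-- The trace `J` of the Schouten tensor, i.e. the `σ₁`-curvature. -/
def schoutenTrace (x : Euc d) : ℝ :=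
  ∑ i, ∑ j, (g x)⁻¹ i j * schouten g i j x

/-- The squared norm `|P|²` of the Schouten tensor with respect to `g`. -/
def schoutenNormSq (x : Euc d) : ℝ :=
  ∑ i, ∑ j, ∑ k, ∑ l, (g x)⁻¹ i k * (g x)⁻¹ j l * schouten g i j x * schouten g k l x

/-- The `σ₂`-curvature `(J² - |P|²) / 2` of `g`. -/
def sigma2Curv (x : Euc d) : ℝ :=
  (1 / 2) * (schoutenTrace g x ^ 2 - schoutenNormSq g x)

/-- The `g`-unit normal, pointing away from the origin, of the sphere centred at the origin
through `x ≠ 0`: the `g`-gradient of `|x|²/2` (whose differential has components `x_j`), divided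
by its `g`-norm.  On the unit sphere it is the outward unit normal `η` of the unit ball. -/
def unitNormal (i : Fin d) (x : Euc d) : ℝ :=
  (∑ j, (g x)⁻¹ i j * x j) / √(∑ k, ∑ j, (g x)⁻¹ k j * x k * x j)

/-- The components `(∇η)_{ij} = g(∇_{∂_i} η, ∂_j)` of the covariant derivative of the normal. -/
def normalDerivative (i j : Fin d) (x : Euc d) : ℝ :=
  ∑ l, g x j l * (pderiv i (unitNormal g l) x + ∑ k, christoffel g l i k x * unitNormal g k x)

/-- The trace, with respect to the metric induced by `g` on the sphere centred at the origin
through `x`, of (the tangential part of) the bilinear form with components `A i j`. -/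
def tangentialTrace (A : Fin d → Fin d → ℝ) (x : Euc d) : ℝ :=
  ∑ i, ∑ j, ((g x)⁻¹ i j - unitNormal g i x * unitNormal g j x) * A i j

/-- The mean curvature `H = (1/n) tr ∇η`, `n = d - 1`; it is `1` on the Euclidean unit sphere. -/
def meanCurv (x : Euc d) : ℝ :=
  (1 / ((d : ℝ) - 1)) * tangentialTrace g (fun i j => normalDerivative g i j x) x

/-- The `H₂`-curvature `H tr(P|_{TM}) + (n/3) H³` of an umbilic boundary, `n = d - 1`. -/
def H2Curv (x : Euc d) : ℝ :=
  meanCurv g x * tangentialTrace g (fun i j => schouten g i j x) x +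
    ((d : ℝ) - 1) / 3 * meanCurv g x ^ 3

end Riemannian

/-! ### Conformally flat metrics on the unit ball of `ℝ^{n+1}` -/

/-- The conformally flat metric `g_u = u^{8/(n-3)} dx²` on `ℝ^{n+1}`, where `u > 0`. -/
def confMetric (n : ℕ) (u : Euc (n + 1) → ℝ) (x : Euc (n + 1)) :
    Matrix (Fin (n + 1)) (Fin (n + 1)) ℝ :=
  (u x ^ (8 / ((n : ℝ) - 3))) • (1 : Matrix (Fin (n + 1)) (Fin (n + 1)) ℝ)

/-- `L₄(u,u,u) = ((n-3)/4 · u)³ u^{16/(n-3)} σ₂^{g_u}`. -/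
def L4 (n : ℕ) (u : Euc (n + 1) → ℝ) (x : Euc (n + 1)) : ℝ :=
  (((n : ℝ) - 3) / 4 * u x) ^ 3 * u x ^ (16 / ((n : ℝ) - 3)) * sigma2Curv (confMetric n u) x

/-- `B₃(u,u,u) = ((n-3)/4 · u)³ u^{12/(n-3)} H₂^{g_u}`, on the unit sphere. -/
def B3 (n : ℕ) (u : Euc (n + 1) → ℝ) (x : Euc (n + 1)) : ℝ :=
  (((n : ℝ) - 3) / 4 * u x) ^ 3 * u x ^ (12 / ((n : ℝ) - 3)) * H2Curv (confMetric n u) x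

/-- The surface measure on the unit sphere `S^n ⊆ ℝ^{n+1}`. -/
def surface (n : ℕ) : Measure (sphere (0 : Euc (n + 1)) 1) :=
  (volume : Measure (Euc (n + 1))).toSphere

/-- `E₂(u) = ∫_B u L₄(u,u,u) + ∮_{∂B} u B₃(u,u,u)`. -/
def E2 (n : ℕ) (u : Euc (n + 1) → ℝ) : ℝ :=
  (∫ x in closedBall (0 : Euc (n + 1)) 1, u x * L4 n u x) +
    ∫ x : sphere (0 : Euc (n + 1)) 1, u x * B3 n u x ∂(surface n)

/-- `σ₁(u) = -((n-3)/4) u Δu - ((n+1)/4) |∇u|²`. -/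
def sigma1 (n : ℕ) (u : Euc (n + 1) → ℝ) (x : Euc (n + 1)) : ℝ :=
  -(((n : ℝ) - 3) / 4) * u x * Δ u x - ((n : ℝ) + 1) / 4 * ‖∇ u x‖ ^ 2

/-- `H(u) = ηu + ((n-3)/4) u` on the unit sphere, where `η = x` is the Euclidean outward normal. -/
def meanH (n : ℕ) (u : Euc (n + 1) → ℝ) (x : Euc (n + 1)) : ℝ :=
  fderiv ℝ u x x + ((n : ℝ) - 3) / 4 * u x

/-- The cone `C₁` of positive `u ∈ C^∞(B)` with `σ₁(u) ≥ 0` in the ball and `H(u) > 0` on its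
boundary.  A function is smooth on the closed ball `B` (a manifold with boundary) if it is the
restriction of a smooth function on `ℝ^{n+1}`; the elements of the set are such extensions, and
all conditions concern the values (and the derivatives, which they determine) on `B` only. -/
def C1 (n : ℕ) : Set (Euc (n + 1) → ℝ) :=
  {u | ContDiff ℝ ∞ u ∧
    (∀ x ∈ closedBall (0 : Euc (n + 1)) 1, 0 < u x) ∧
    (∀ x ∈ closedBall (0 : Euc (n + 1)) 1, 0 ≤ sigma1 n u x) ∧
    (∀ x ∈ sphere (0 : Euc (n + 1)) 1, 0 < meanH n u x)}

end SobolevTrace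

end

/-! The energy dominates a full W^{1,4} norm on the cone, and a Sobolev trace inequality then bounds
it below. Write k = (n-3)/4, p = ηu on the sphere, and ∇'u for the tangential gradient.

The energy. For a metric e^{2f}dx² with f = (4/(n-3)) log u, every curvature is explicit in the
2-jet of u, and the powers of u in `L4` and `B3` cancel all conformal factors. In the interior,
|∇u|²(σ₁(u) + |∇u|²/2) differs from u L₄ by the divergence of two explicit fields. The second
derivatives left on the sphere cancel after one tangential integration by parts against ψ = (k/2)u²p
+ k²u³. The outcome, `E2_eq`, has interior integrand |∇u|²(σ₁(u) + |∇u|²/2) and boundary integrand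
ku|∇'u|²(H(u) + ku) + (k/3)u(p³ + nk²u³). Since σ₁ ≥ 0, the first is at least |∇u|⁴/2. Since H > 0,
p > -ku, and the second is at least k³((n+1)/4)u⁴. This is `E2_ge`.

The trace inequality. `exists_sobolev_trace` bounds ∫|∇u|⁴ + ∮u⁴ below when ∮|u|^q = 1, q =
4n/(n-3). The L¹ Sobolev inequality on the ball with a boundary term (`exists_ball_sobolev_one`),
applied to |u|^q, controls the critical interior norm. The identity ∮f = (n+1)∫f + ∫ x·∇f, again for
|u|^q, then shows that a small left-hand side cannot carry unit boundary mass.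

The divergence theorem on the ball (`integral_pderiv_ball`) is derived from polar coordinates and
whole-space integration by parts against radial weights. -/

noncomputable section

namespace SobolevTrace

/-! ### Coordinate derivatives, gradient and Laplacian in Euclidean space. -/

section Calculus

variable {d : ℕ} {f g : Euc d → ℝ} {x : Euc d}

lemma pderiv_congr (i : Fin d) (h : f =ᶠ[nhds x] g) : pderiv i f x = pderiv i g x := by
  simp only [pderiv, h.fderiv_eq]

lemma pderiv_add (i : Fin d) (hf : DifferentiableAt ℝ f x) (hg : DifferentiableAt ℝ g x) :
    pderiv i (fun y => f y + g y) x = pderiv i f x + pderiv i g x := by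
  simp only [pderiv, fderiv_fun_add hf hg, add_apply]

lemma pderiv_sub (i : Fin d) (hf : DifferentiableAt ℝ f x) (hg : DifferentiableAt ℝ g x) :
    pderiv i (fun y => f y - g y) x = pderiv i f x - pderiv i g x := by
  simp only [pderiv, fderiv_fun_sub hf hg, sub_apply]

lemma pderiv_mul (i : Fin d) (hf : DifferentiableAt ℝ f x) (hg : DifferentiableAt ℝ g x) :
    pderiv i (fun y => f y * g y) x = pderiv i f x * g x + f x * pderiv i g x := by
  simp only [pderiv, fderiv_fun_mul hf hg, add_apply, smul_apply,
    smul_eq_mul]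
  ring

lemma pderiv_const (i : Fin d) (c : ℝ) : pderiv i (fun _ : Euc d => c) x = 0 := by
  simp [pderiv]

lemma pderiv_const_mul (i : Fin d) (c : ℝ) (hf : DifferentiableAt ℝ f x) :
    pderiv i (fun y => c * f y) x = c * pderiv i f x := by
  rw [pderiv_mul i (differentiableAt_const c) hf, pderiv_const]; ring

lemma pderiv_sum {ι : Type*} (s : Finset ι) (F : ι → Euc d → ℝ) (i : Fin d)
    (hF : ∀ j ∈ s, DifferentiableAt ℝ (F j) x) :
    pderiv i (fun y => ∑ j ∈ s, F j y) x = ∑ j ∈ s, pderiv i (F j) x := by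
  simp only [pderiv, fderiv_fun_sum hF, sum_apply]

/-- The chain rule for a function of one variable after `f`. -/
lemma pderiv_comp {φ : ℝ → ℝ} {φ' : ℝ} (i : Fin d) (hφ : HasDerivAt φ φ' (f x))
    (hf : DifferentiableAt ℝ f x) : pderiv i (fun y => φ (f y)) x = φ' * pderiv i f x := by
  have := (hφ.comp_hasFDerivAt x hf.hasFDerivAt).fderiv
  simp only [Function.comp_def] at this
  simp [pderiv, this]

lemma pderiv_pow (i : Fin d) (m : ℕ) (hf : DifferentiableAt ℝ f x) :
    pderiv i (fun y => f y ^ m) x = m * f x ^ (m - 1) * pderiv i f x :=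
  pderiv_comp i (hasDerivAt_pow m (f x)) hf

lemma pderiv_coord (i j : Fin d) : pderiv i (fun y : Euc d => y j) x = if i = j then 1 else 0 := by
  have : HasFDerivAt (fun y : Euc d => y j) (EuclideanSpace.proj j : Euc d →L[ℝ] ℝ) x :=
    (EuclideanSpace.proj j : Euc d →L[ℝ] ℝ).hasFDerivAt
  simp only [pderiv, this.fderiv]
  simp [eq_comm]

lemma contDiff_coord (j : Fin d) {m : WithTop ℕ∞} : ContDiff ℝ m (fun y : Euc d => y j) :=
  (EuclideanSpace.proj j : Euc d →L[ℝ] ℝ).contDiff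

lemma differentiable_coord (j : Fin d) : Differentiable ℝ (fun y : Euc d => y j) :=
  (contDiff_coord j (m := 1)).differentiable one_ne_zero

lemma contDiff_pderiv (i : Fin d) (hf : ContDiff ℝ ∞ f) : ContDiff ℝ ∞ (pderiv i f) := by
  unfold pderiv
  exact (hf.fderiv_right (m := ∞) (by simp)).clm_apply contDiff_const

lemma continuous_pderiv (i : Fin d) (hf : ContDiff ℝ 1 f) : Continuous (pderiv i f) := by
  unfold pderiv
  exact (hf.continuous_fderiv one_ne_zero).clm_apply continuous_const

lemma pderiv_comm (i j : Fin d) (hf : ContDiff ℝ ∞ f) :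
    pderiv i (pderiv j f) x = pderiv j (pderiv i f) x := by
  have hs : IsSymmSndFDerivAt ℝ f x :=
    hf.contDiffAt.isSymmSndFDerivAt (by rw [minSmoothness_of_isRCLikeNormedField]; exact WithTop.coe_le_coe.2 (le_top : (2 : ℕ∞) ≤ ⊤))
  have hd : DifferentiableAt ℝ (fderiv ℝ f) x :=
    ((hf.fderiv_right (m := ∞) (by simp)).differentiable (by simp)) x
  have key : ∀ a b : Fin d, pderiv a (pderiv b f) x =
      fderiv ℝ (fderiv ℝ f) x (EuclideanSpace.single a 1) (EuclideanSpace.single b 1) := by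
    intro a b
    change fderiv ℝ (fun y => fderiv ℝ f y (EuclideanSpace.single b 1)) x _ = _
    rw [fderiv_clm_apply hd (differentiableAt_const _)]
    simp
  rw [key, key]
  exact hs _ _

lemma fderiv_eq_sum (f : Euc d → ℝ) (x y : Euc d) : fderiv ℝ f x y = ∑ i, y i * pderiv i f x := by
  conv_lhs => rw [← (EuclideanSpace.basisFun (Fin d) ℝ).sum_repr y]
  simp [pderiv, map_sum]

lemma norm_gradient_sq (f : Euc d → ℝ) (x : Euc d) : ‖∇ f x‖ ^ 2 = ∑ i, pderiv i f x ^ 2 := by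
  rw [EuclideanSpace.norm_sq_eq]
  refine Finset.sum_congr rfl fun i _ => ?_
  have h : inner ℝ (∇ f x) (EuclideanSpace.single i (1 : ℝ)) = pderiv i f x := by
    simp [gradient, pderiv, InnerProductSpace.toDual_symm_apply]
  rw [← h, EuclideanSpace.inner_single_right]
  simp

lemma norm_fderiv_sq (f : Euc d → ℝ) (x : Euc d) : ‖fderiv ℝ f x‖ ^ 2 = ∑ i, pderiv i f x ^ 2 := by
  rw [← norm_gradient_sq, gradient, LinearIsometryEquiv.norm_map]

lemma laplacian_eq_sum (hf : ContDiff ℝ ∞ f) (x : Euc d) :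
    Δ f x = ∑ i, pderiv i (pderiv i f) x := by
  rw [InnerProductSpace.laplacian_eq_iteratedFDeriv_orthonormalBasis f (EuclideanSpace.basisFun (Fin d) ℝ)]
  refine Finset.sum_congr rfl fun i _ => ?_
  have hd : DifferentiableAt ℝ (fderiv ℝ f) x :=
    ((hf.fderiv_right (m := ∞) (by simp)).differentiable (by simp)) x
  change _ = fderiv ℝ (fun y => fderiv ℝ f y (EuclideanSpace.single i 1)) x _
  rw [fderiv_clm_apply hd (differentiableAt_const _), iteratedFDeriv_two_apply]
  simp

lemma sum_sq_coord (x : Euc d) : ∑ i, x i ^ 2 = ‖x‖ ^ 2 := by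
  simp [EuclideanSpace.norm_sq_eq]

end Calculus

/-! ### Curvatures of a general conformally flat metric. -/

section ConformalGeometry

variable {d : ℕ} {lam : Euc d → ℝ} {a : Fin d → Euc d → ℝ} {x : Euc d}

/-- The Kronecker delta. -/
def kron {d : ℕ} (i j : Fin d) : ℝ := if i = j then 1 else 0

lemma kron_comm (i j : Fin d) : kron i j = kron j i := by simp [kron, eq_comm]

lemma kron_self (i : Fin d) : kron i i = 1 := by simp [kron]

lemma sum_kron_mul (i : Fin d) (f : Fin d → ℝ) : ∑ j, kron i j * f j = f i := by simp [kron]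

lemma sum_kron_mul' (i : Fin d) (f : Fin d → ℝ) : ∑ j, kron j i * f j = f i := by simp [kron]

lemma conformal_apply (i j : Fin d) :
    (lam x • (1 : Matrix (Fin d) (Fin d) ℝ)) i j = kron i j * lam x := by
  simp [kron, Matrix.one_apply]

lemma conformal_inv (h : lam x ≠ 0) (i j : Fin d) :
    (lam x • (1 : Matrix (Fin d) (Fin d) ℝ))⁻¹ i j = kron i j * (lam x)⁻¹ := by
  have : (lam x • (1 : Matrix (Fin d) (Fin d) ℝ))⁻¹ = (lam x)⁻¹ • 1 := by
    apply Matrix.inv_eq_right_inv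
    simp [smul_smul, h]
  rw [this]
  simp [kron, Matrix.one_apply]

lemma pderiv_conformal (k i j : Fin d) :
    pderiv k (fun y => (lam y • (1 : Matrix (Fin d) (Fin d) ℝ)) i j) x =
      kron i j * pderiv k lam x := by
  by_cases h : i = j
  · subst h; simp [kron]
  · simp [kron, h, pderiv_const]

/-- With the metric written as e^{2f}dx², the hypothesis on `a` says a = ∇f. Carrying `a` instead of
f keeps logarithms out of all later formulas. -/
lemma christoffel_conformal (h : lam x ≠ 0) (ha : ∀ i, pderiv i lam x = 2 * lam x * a i x)
    (k i j : Fin d) :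
    christoffel (fun y => lam y • (1 : Matrix (Fin d) (Fin d) ℝ)) k i j x =
      kron j k * a i x + kron i k * a j x - kron i j * a k x := by
  simp only [christoffel, pderiv_conformal, ha, conformal_inv h, mul_assoc, sum_kron_mul]
  field_simp

lemma pderiv_christoffel_conformal (h : ∀ᶠ y in nhds x, lam y ≠ 0)
    (ha : ∀ᶠ y in nhds x, ∀ i, pderiv i lam y = 2 * lam y * a i y)
    (hd : ∀ i, DifferentiableAt ℝ (a i) x) (m k i j : Fin d) :
    pderiv m (christoffel (fun y => lam y • (1 : Matrix (Fin d) (Fin d) ℝ)) k i j) x =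
      kron j k * pderiv m (a i) x + kron i k * pderiv m (a j) x
        - kron i j * pderiv m (a k) x := by
  have e : christoffel (fun y => lam y • (1 : Matrix (Fin d) (Fin d) ℝ)) k i j =ᶠ[nhds x]
      fun y => kron j k * a i y + kron i k * a j y - kron i j * a k y := by
    filter_upwards [h, ha] with y h1 h2
    exact christoffel_conformal h1 h2 k i j
  rw [pderiv_congr m e, pderiv_sub, pderiv_add, pderiv_const_mul, pderiv_const_mul,
    pderiv_const_mul]
  all_goals fun_prop (disch := exact hd _)

/-- This is the classical conformal change formula with flat background, a = ∇f; `hs` is the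
symmetry of the Hessian of f. In the proof `e1` collects the terms linear in derivatives of `a`, and
`e2` the quadratic ones. -/
lemma ricci_conformal (h : ∀ᶠ y in nhds x, lam y ≠ 0)
    (ha : ∀ᶠ y in nhds x, ∀ i, pderiv i lam y = 2 * lam y * a i y)
    (hd : ∀ i, DifferentiableAt ℝ (a i) x)
    (hs : ∀ i j, pderiv i (a j) x = pderiv j (a i) x) (i j : Fin d) :
    ricci (fun y => lam y • (1 : Matrix (Fin d) (Fin d) ℝ)) i j x =
      ((d : ℝ) - 2) * (a i x * a j x - pderiv j (a i) x)
        - kron i j * (∑ k, pderiv k (a k) x + ((d : ℝ) - 2) * ∑ k, a k x ^ 2) := by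
  simp only [ricci, christoffel_conformal h.self_of_nhds ha.self_of_nhds,
    pderiv_christoffel_conformal h ha hd]
  have e1 : ∑ k, (kron j k * pderiv k (a i) x + kron i k * pderiv k (a j) x
      - kron i j * pderiv k (a k) x - (kron k k * pderiv j (a i) x + kron i k * pderiv j (a k) x
      - kron i k * pderiv j (a k) x)) =
      (2 - (d : ℝ)) * pderiv j (a i) x - kron i j * ∑ k, pderiv k (a k) x := by
    simp only [Finset.sum_sub_distrib, Finset.sum_add_distrib, kron_self, sum_kron_mul,
      ← Finset.mul_sum, hs i j, one_mul, Finset.sum_const, Finset.card_univ, Fintype.card_fin,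
      nsmul_eq_mul]
    ring
  have e2 : ∀ k, ∑ l, ((kron l k * a k x + kron k k * a l x - kron k l * a k x) *
      (kron j l * a i x + kron i l * a j x - kron i j * a l x) -
      (kron l k * a j x + kron j k * a l x - kron j l * a k x) *
      (kron k l * a i x + kron i l * a k x - kron i k * a l x)) =
      2 * (a i x * a j x) - kron i j * ∑ l, a l x ^ 2 - (kron k k * (a i x * a j x))
        - kron i k * (a k x * a j x) + kron i k * (a k x * a j x)
        - kron j k * (a k x * a i x) - kron j k * (a i x * a k x)
        + kron j k * (kron i k * ∑ l, a l x ^ 2)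
        + kron j k * (a k x * a i x) + kron i j * a k x ^ 2 - kron i k * (a k x * a j x) := by
    intro k
    have : ∀ l, ((kron l k * a k x + kron k k * a l x - kron k l * a k x) *
      (kron j l * a i x + kron i l * a j x - kron i j * a l x) -
      (kron l k * a j x + kron j k * a l x - kron j l * a k x) *
      (kron k l * a i x + kron i l * a k x - kron i k * a l x)) =
      kron j l * (a l x * a i x) + kron i l * (a l x * a j x) - kron i j * a l x ^ 2
      - (kron k l * (kron k l * a j x * a i x) + kron k l * (kron i l * a j x * a k x)
        - kron k l * (kron i k * a l x * a j x)
        + kron k l * (kron j k * a l x * a i x) + kron i l * (kron j k * a l x * a k x)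
        - kron j k * kron i k * a l x ^ 2
        - kron j l * (kron k l * a k x * a i x) - kron j l * (kron i l * a k x ^ 2)
        + kron j l * (kron i k * a k x * a l x)) := by
      intro l
      rw [kron_self, kron_comm l k]; ring
    rw [Finset.sum_congr rfl fun l _ => this l]
    simp only [Finset.sum_sub_distrib, Finset.sum_add_distrib, kron_self, sum_kron_mul,
      ← Finset.mul_sum, kron_comm k j, kron_comm i j]
    ring
  rw [Finset.sum_congr rfl fun k _ => e2 k, e1]
  simp only [Finset.sum_sub_distrib, Finset.sum_add_distrib, kron_self, sum_kron_mul,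
      ← Finset.mul_sum, one_mul, Finset.sum_const, Finset.card_univ, Fintype.card_fin,
      nsmul_eq_mul, kron_comm i j]
  ring

lemma scalarCurv_conformal (h : ∀ᶠ y in nhds x, lam y ≠ 0)
    (ha : ∀ᶠ y in nhds x, ∀ i, pderiv i lam y = 2 * lam y * a i y)
    (hd : ∀ i, DifferentiableAt ℝ (a i) x)
    (hs : ∀ i j, pderiv i (a j) x = pderiv j (a i) x) :
    scalarCurv (fun y => lam y • (1 : Matrix (Fin d) (Fin d) ℝ)) x =
      -(lam x)⁻¹ * ((d : ℝ) - 1) *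
        (2 * ∑ k, pderiv k (a k) x + ((d : ℝ) - 2) * ∑ k, a k x ^ 2) := by
  simp only [scalarCurv, ricci_conformal h ha hd hs, conformal_inv h.self_of_nhds, mul_assoc,
    sum_kron_mul, kron_self]
  simp only [← Finset.mul_sum, Finset.sum_sub_distrib, Finset.sum_const, Finset.card_univ,
    Fintype.card_fin, nsmul_eq_mul, ← pow_two]
  ring

/-- The Schouten normalization removes the Laplacian of f from the Ricci tensor, leaving df⊗df − ∇²f
− |∇f|²δ/2. From this point all curvatures are algebra. -/
lemma schouten_conformal (hd3 : 3 ≤ d) (h : ∀ᶠ y in nhds x, lam y ≠ 0)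
    (ha : ∀ᶠ y in nhds x, ∀ i, pderiv i lam y = 2 * lam y * a i y)
    (hd : ∀ i, DifferentiableAt ℝ (a i) x)
    (hs : ∀ i j, pderiv i (a j) x = pderiv j (a i) x) (i j : Fin d) :
    schouten (fun y => lam y • (1 : Matrix (Fin d) (Fin d) ℝ)) i j x =
      a i x * a j x - pderiv j (a i) x - kron i j * (∑ k, a k x ^ 2) / 2 := by
  have h3 : (3 : ℝ) ≤ d := by exact_mod_cast hd3
  have h1 : (d : ℝ) - 1 ≠ 0 := by linarith
  have h2 : (d : ℝ) - 2 ≠ 0 := by linarith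
  have hl := h.self_of_nhds
  simp only [schouten, ricci_conformal h ha hd hs, scalarCurv_conformal h ha hd hs,
    conformal_apply]
  field_simp
  ring

lemma sigma2Curv_conformal (h : lam x ≠ 0) :
    sigma2Curv (fun y => lam y • (1 : Matrix (Fin d) (Fin d) ℝ)) x =
      (lam x)⁻¹ ^ 2 * ((1 / 2) *
        ((∑ i, schouten (fun y => lam y • (1 : Matrix (Fin d) (Fin d) ℝ)) i i x) ^ 2 -
          ∑ i, ∑ j, schouten (fun y => lam y • (1 : Matrix (Fin d) (Fin d) ℝ)) i j x ^ 2)) := by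
  simp only [sigma2Curv, schoutenTrace, schoutenNormSq, conformal_inv h, mul_assoc, sum_kron_mul]
  have : ∀ i j : Fin d, (∑ k, ∑ l, kron i k * ((lam x)⁻¹ * (kron j l * ((lam x)⁻¹ *
      (schouten (fun y => lam y • (1 : Matrix (Fin d) (Fin d) ℝ)) i j x *
      schouten (fun y => lam y • (1 : Matrix (Fin d) (Fin d) ℝ)) k l x))))) =
      (lam x)⁻¹ ^ 2 * schouten (fun y => lam y • (1 : Matrix (Fin d) (Fin d) ℝ)) i j x ^ 2 := by
    intro i j
    simp only [← Finset.mul_sum, sum_kron_mul]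
    ring
  rw [Finset.sum_congr rfl fun i _ => Finset.sum_congr rfl fun j _ => this i j]
  simp only [← Finset.mul_sum]
  ring

lemma unitNormal_conformal (h : 0 < lam x) (i : Fin d) :
    unitNormal (fun y => lam y • (1 : Matrix (Fin d) (Fin d) ℝ)) i x =
      (√(lam x))⁻¹ * (x i * ‖x‖⁻¹) := by
  simp only [unitNormal, conformal_inv h.ne', mul_assoc, sum_kron_mul, ← Finset.mul_sum, ← pow_two,
    sum_sq_coord]
  rw [Real.sqrt_mul (by positivity), Real.sqrt_sq (norm_nonneg _), Real.sqrt_inv]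
  have h1 : √(lam x) ≠ 0 := by positivity
  have h2 : (lam x)⁻¹ = (√(lam x))⁻¹ * (√(lam x))⁻¹ := by
    rw [← mul_inv, Real.mul_self_sqrt h.le]
  rw [h2]
  field_simp

lemma tangentialTrace_conformal (h : 0 < lam x) (hx : ‖x‖ = 1) (A : Fin d → Fin d → ℝ) :
    tangentialTrace (fun y => lam y • (1 : Matrix (Fin d) (Fin d) ℝ)) A x =
      (lam x)⁻¹ * (∑ i, A i i - ∑ i, ∑ j, x i * x j * A i j) := by
  have h2 : (lam x)⁻¹ = (√(lam x))⁻¹ * (√(lam x))⁻¹ := by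
    rw [← mul_inv, Real.mul_self_sqrt h.le]
  simp only [tangentialTrace, unitNormal_conformal h, conformal_inv h.ne', hx, sub_mul,
    Finset.sum_sub_distrib, mul_assoc, sum_kron_mul, ← Finset.mul_sum, mul_sub]
  simp only [mul_left_comm _ (√(lam x))⁻¹, ← Finset.mul_sum, h2]
  simp
  ring

lemma pderiv_norm_inv (hx : ‖x‖ = 1) (i : Fin d) : pderiv i (fun y : Euc d => ‖y‖⁻¹) x = -x i := by
  have e : (fun y : Euc d => ‖y‖⁻¹) = fun y => (fun t : ℝ => (√t)⁻¹) (∑ j, y j ^ 2) := by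
    funext y; simp [EuclideanSpace.norm_eq]
  have hsum : ∑ j, x j ^ 2 = 1 := by rw [sum_sq_coord, hx]; norm_num
  have hφ : HasDerivAt (fun t : ℝ => (√t)⁻¹) (-(1 / 2)) (∑ j, x j ^ 2) := by
    rw [hsum]
    have := (Real.hasDerivAt_sqrt (one_ne_zero)).inv (by simp)
    convert! this using 1
    norm_num
  have hdc := fun j : Fin d => (differentiable_coord j) x
  rw [e, pderiv_comp (φ := fun t : ℝ => (√t)⁻¹) (f := fun y : Euc d => ∑ j, y j ^ 2) i hφ
    (DifferentiableAt.fun_sum fun j _ => (hdc j).pow 2), pderiv_sum]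
  · simp only [pderiv_pow i 2 (hdc _), pderiv_coord]
    simp
  · intro j _; exact (hdc j).pow 2

/-- The normal is a field defined off the sphere as well, so its derivative sees the factor |y|⁻¹,
whose gradient at |x| = 1 is −x. The last term is not symmetric in i and j, since it records the
normal derivative of this particular extension. -/
lemma normalDerivative_conformal (h : ∀ᶠ y in nhds x, 0 < lam y)
    (ha : ∀ᶠ y in nhds x, ∀ i, pderiv i lam y = 2 * lam y * a i y)
    (hl : DifferentiableAt ℝ lam x) (hx : ‖x‖ = 1) (i j : Fin d) :
    normalDerivative (fun y => lam y • (1 : Matrix (Fin d) (Fin d) ℝ)) i j x =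
      √(lam x) * (kron i j - x i * x j + kron i j * (∑ k, a k x * x k) - x i * a j x) := by
  have hpos := h.self_of_nhds
  have e : ∀ l, pderiv i (unitNormal (fun y => lam y • (1 : Matrix (Fin d) (Fin d) ℝ)) l) x =
      (√(lam x))⁻¹ * (kron i l - x i * x l - a i x * x l) := by
    intro l
    have e0 : unitNormal (fun y => lam y • (1 : Matrix (Fin d) (Fin d) ℝ)) l =ᶠ[nhds x]
        fun y => (fun t : ℝ => (√t)⁻¹) (lam y) * (y l * ‖y‖⁻¹) := by
      filter_upwards [h] with y hy
      exact unitNormal_conformal hy l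
    have hφ : HasDerivAt (fun t : ℝ => (√t)⁻¹) (-(1 / (2 * √(lam x))) / (√(lam x)) ^ 2) (lam x) :=
      (Real.hasDerivAt_sqrt hpos.ne').inv (by positivity)
    have hx0 : x ≠ 0 := by rintro rfl; simp at hx
    have hn : DifferentiableAt ℝ (fun y : Euc d => ‖y‖⁻¹) x :=
      (differentiableAt_id.norm ℝ hx0).inv (by simpa using hx0)
    have hc := (differentiable_coord l) x
    rw [pderiv_congr i e0, pderiv_mul (f := fun y => (√(lam y))⁻¹) (g := fun y => y l * ‖y‖⁻¹) i
      (hφ.differentiableAt.comp x hl) (hc.mul hn), pderiv_comp i hφ hl, pderiv_mul i hc hn, pderiv_norm_inv hx, pderiv_coord,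
      ha.self_of_nhds, hx]
    have hs : lam x = √(lam x) ^ 2 := (Real.sq_sqrt hpos.le).symm
    have hs0 : √(lam x) ≠ 0 := by positivity
    set s := √(lam x)
    rw [hs]
    simp only [kron]
    field_simp
    ring
  simp only [normalDerivative, conformal_apply, e,
    christoffel_conformal hpos.ne' ha.self_of_nhds, unitNormal_conformal hpos, hx, mul_assoc,
    sum_kron_mul]
  have e2 : ∑ k, (kron k j * a i x + kron i j * a k x - kron i k * a j x) *
      ((√(lam x))⁻¹ * (x k * 1⁻¹)) =
      (√(lam x))⁻¹ * (a i x * x j + kron i j * (∑ k, a k x * x k) - x i * a j x) := by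
    have : ∀ k, (kron k j * a i x + kron i j * a k x - kron i k * a j x) *
      ((√(lam x))⁻¹ * (x k * 1⁻¹)) = kron j k * ((√(lam x))⁻¹ * (a i x * x k)) +
        (√(lam x))⁻¹ * kron i j * (a k x * x k)
        - kron i k * ((√(lam x))⁻¹ * (a j x * x k)) := by
      intro k; rw [kron_comm k j, inv_one]; ring
    simp only [this, Finset.sum_sub_distrib, Finset.sum_add_distrib, sum_kron_mul,
      ← Finset.mul_sum]
    ring
  rw [e2]
  have hs : lam x = √(lam x) ^ 2 := (Real.sq_sqrt hpos.le).symm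
  have hs0 : √(lam x) ≠ 0 := by positivity
  set s := √(lam x)
  rw [hs]
  field_simp
  ring

lemma meanCurv_conformal (hd2 : 2 ≤ d) (h : ∀ᶠ y in nhds x, 0 < lam y)
    (ha : ∀ᶠ y in nhds x, ∀ i, pderiv i lam y = 2 * lam y * a i y)
    (hl : DifferentiableAt ℝ lam x) (hx : ‖x‖ = 1) :
    meanCurv (fun y => lam y • (1 : Matrix (Fin d) (Fin d) ℝ)) x =
      (√(lam x))⁻¹ * (1 + ∑ k, a k x * x k) := by
  have h2 : (2 : ℝ) ≤ d := by exact_mod_cast hd2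
  have h1 : (d : ℝ) - 1 ≠ 0 := by linarith
  have hpos := h.self_of_nhds
  have hsum : ∑ j, x j ^ 2 = 1 := by rw [sum_sq_coord, hx]; norm_num
  rw [meanCurv, tangentialTrace_conformal hpos hx]
  simp only [normalDerivative_conformal h ha hl hx]
  set T := ∑ k, a k x * x k with hT
  have e1 : ∑ i, √(lam x) * (kron i i - x i * x i + kron i i * T - x i * a i x) =
      √(lam x) * ((d : ℝ) - 1) * (1 + T) := by
    rw [← Finset.mul_sum]
    simp only [kron_self, Finset.sum_sub_distrib, Finset.sum_add_distrib, Finset.sum_const,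
      Finset.card_univ, Fintype.card_fin, nsmul_eq_mul, ← pow_two, hsum, mul_comm (x _) (a _ x),
      ← hT]
    ring
  -- The normal-normal component vanishes because the normal has constant length 1. Hence the full
  -- trace already equals the tangential one.
  have e2 : ∑ i, ∑ j, x i * x j * (√(lam x) * (kron i j - x i * x j + kron i j * T - x i * a j x))
      = 0 := by
    have : ∀ i j, x i * x j * (√(lam x) * (kron i j - x i * x j + kron i j * T - x i * a j x)) =
      √(lam x) * (kron i j * (x i * x j * (1 + T)) - x i ^ 2 * x j ^ 2 -
        x i ^ 2 * (a j x * x j)) := by intro i j; ring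
    simp only [this, ← Finset.mul_sum, Finset.sum_sub_distrib, sum_kron_mul, hsum, ← hT]
    simp only [← Finset.sum_mul, ← pow_two, hsum]
    ring
  rw [e1, e2]
  have hs : lam x = √(lam x) ^ 2 := (Real.sq_sqrt hpos.le).symm
  have hs0 : √(lam x) ≠ 0 := by positivity
  set s := √(lam x)
  rw [hs]
  field_simp
  ring

end ConformalGeometry

/-! ### The curvatures of `confMetric` as polynomials in the 2-jet of u. -/

section ConfMetric

variable {n : ℕ} {u : Euc (n + 1) → ℝ} {x : Euc (n + 1)}

lemma pderiv_conformalFactor (hn : 4 ≤ n) (hu : ContDiff ℝ ∞ u) (hx : 0 < u x)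
    (i : Fin (n + 1)) :
    pderiv i (fun y => u y ^ (8 / ((n : ℝ) - 3))) x =
      2 * u x ^ (8 / ((n : ℝ) - 3)) * (4 / ((n : ℝ) - 3) * (pderiv i u x / u x)) := by
  have h4 : (4 : ℝ) ≤ n := by exact_mod_cast hn
  have h3 : (n : ℝ) - 3 ≠ 0 := by linarith
  rw [pderiv_comp i (Real.hasDerivAt_rpow_const (Or.inl hx.ne'))
    (hu.differentiable (by simp) x), Real.rpow_sub_one hx.ne']
  field_simp
  ring

lemma eventually_pos (hu : ContDiff ℝ ∞ u) (hx : 0 < u x) : ∀ᶠ y in nhds x, 0 < u y :=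
  hu.continuous.continuousAt.eventually (lt_mem_nhds hx)

lemma differentiableAt_logDeriv (hu : ContDiff ℝ ∞ u) (hx : 0 < u x) (c : ℝ) (i : Fin (n + 1)) :
    DifferentiableAt ℝ (fun y => c * (pderiv i u y / u y)) x :=
  ((((contDiff_pderiv i hu).differentiable (by simp)) x).fun_mul
    ((hu.differentiable (by simp) x).fun_inv hx.ne')).const_mul c

lemma pderiv_logDeriv (hu : ContDiff ℝ ∞ u) (hx : 0 < u x) (c : ℝ) (i j : Fin (n + 1)) :
    pderiv j (fun y => c * (pderiv i u y / u y)) x =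
      c * (pderiv j (pderiv i u) x / u x - pderiv i u x * pderiv j u x / u x ^ 2) := by
  have h1 := ((contDiff_pderiv i hu).differentiable (by simp)) x
  have h2 := hu.differentiable (by simp) x
  have h3 : HasDerivAt (fun t : ℝ => t⁻¹) (-(u x ^ 2)⁻¹) (u x) := hasDerivAt_inv hx.ne'
  simp only [div_eq_mul_inv]
  rw [pderiv_const_mul j c (h1.fun_mul (h2.fun_inv hx.ne')),
    pderiv_mul (g := fun y => (u y)⁻¹) j h1 (h2.inv hx.ne'), pderiv_comp j h3 h2]
  ring

/-- Here f = (4/(n-3)) log u, so each derivative of f brings 1/(ku) with k = (n-3)/4. Pulling out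
(ku)⁻² leaves a quadratic polynomial in u, ∇u, ∇²u, of the form cD + e v⊗v − fδ whose trace,
contraction and norm come next. -/
lemma schouten_confMetric (hn : 4 ≤ n) (hu : ContDiff ℝ ∞ u) (hx : 0 < u x)
    (i j : Fin (n + 1)) :
    schouten (confMetric n u) i j x = (((n : ℝ) - 3) / 4 * u x)⁻¹ ^ 2 *
      (-(((n : ℝ) - 3) / 4 * u x) * pderiv j (pderiv i u) x
        + ((n : ℝ) + 1) / 4 * (pderiv i u x * pderiv j u x)
        - kron i j * (∑ k, pderiv k u x ^ 2) / 2) := by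
  have h4 : (4 : ℝ) ≤ n := by exact_mod_cast hn
  have h3 : (n : ℝ) - 3 ≠ 0 := by linarith
  have hpos := eventually_pos hu hx
  have := schouten_conformal (lam := fun y => u y ^ (8 / ((n : ℝ) - 3)))
    (a := fun i y => 4 / ((n : ℝ) - 3) * (pderiv i u y / u y)) (x := x) (by lia)
    (hpos.mono fun y hy => (Real.rpow_pos_of_pos hy _).ne')
    (hpos.mono fun y hy i => pderiv_conformalFactor hn hu hy i)
    (fun i => differentiableAt_logDeriv hu hx _ i)
    (fun i j => by
      rw [pderiv_logDeriv hu hx, pderiv_logDeriv hu hx, pderiv_comm i j hu]; ring) i j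
  change schouten (fun y => u y ^ (8 / ((n : ℝ) - 3)) • 1) i j x = _
  rw [this, pderiv_logDeriv hu hx]
  simp only [mul_pow, div_pow, ← Finset.mul_sum, ← Finset.sum_div]
  field_simp
  ring

lemma sum_schoutenForm_diag (c e f : ℝ) (v D : Fin (n + 1) → ℝ) :
    ∑ i, (c * D i + e * (v i * v i) - kron i i * f) =
      c * ∑ i, D i + e * ∑ i, v i ^ 2 - (n + 1) * f := by
  simp [Finset.sum_sub_distrib, Finset.sum_add_distrib, ← Finset.mul_sum, kron_self, pow_two]

lemma sum_schoutenForm_contract (c e f : ℝ) (w v : Fin (n + 1) → ℝ)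
    (D : Fin (n + 1) → Fin (n + 1) → ℝ) :
    ∑ i, ∑ j, w i * w j * (c * D i j + e * (v i * v j) - kron i j * f) =
      c * ∑ i, ∑ j, w i * w j * D i j + e * (∑ i, w i * v i) ^ 2 - (∑ i, w i ^ 2) * f := by
  have : ∀ i j, w i * w j * (c * D i j + e * (v i * v j) - kron i j * f) =
      c * (w i * w j * D i j) + e * ((w i * v i) * (w j * v j)) - kron i j * (w i * w j * f) := by
    intro i j; ring
  rw [Finset.sum_congr rfl fun i _ => Finset.sum_congr rfl fun j _ => this i j]
  simp only [Finset.sum_sub_distrib, Finset.sum_add_distrib, ← Finset.mul_sum, sum_kron_mul,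
    ← Finset.sum_mul, pow_two]

lemma sum_schoutenForm_sq (c e f : ℝ) (v : Fin (n + 1) → ℝ)
    (D : Fin (n + 1) → Fin (n + 1) → ℝ) :
    ∑ i, ∑ j, (c * D i j + e * (v i * v j) - kron i j * f) ^ 2 =
      c ^ 2 * ∑ i, ∑ j, D i j ^ 2 + 2 * c * e * ∑ i, ∑ j, v i * v j * D i j
        - 2 * c * f * ∑ i, D i i + e ^ 2 * (∑ i, v i ^ 2) ^ 2 - 2 * e * f * ∑ i, v i ^ 2
        + (n + 1) * f ^ 2 := by
  have : ∀ i j, (c * D i j + e * (v i * v j) - kron i j * f) ^ 2 =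
      c ^ 2 * D i j ^ 2 + 2 * c * e * (v i * v j * D i j) + e ^ 2 * (v i ^ 2 * v j ^ 2)
        - kron i j * (2 * c * f * D i j) - kron i j * (2 * e * f * (v i * v j))
        + kron i j * (kron i j * f ^ 2) := by
    intro i j; ring
  rw [Finset.sum_congr rfl fun i _ => Finset.sum_congr rfl fun j _ => this i j]
  simp only [Finset.sum_sub_distrib, Finset.sum_add_distrib, ← Finset.mul_sum, sum_kron_mul,
    ← Finset.sum_mul, kron_self, ← pow_two]
  simp
  ring

/-- The two index raisings in σ₂ contribute λ⁻² with λ = u^{8/(n-3)}, which the power in `L4`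
cancels. The |∇u|⁴ terms of J² and |P|² agree, since the coefficient (n+1)/4 of ∇u⊗∇u matches the
dimension n+1; what remains is divisible by k. -/
lemma mul_L4_eq (hn : 4 ≤ n) (hu : ContDiff ℝ ∞ u) (hx : 0 < u x) :
    u x * L4 n u x = ((n : ℝ) - 3) / 8 * u x ^ 2 *
        ((∑ i, pderiv i (pderiv i u) x) ^ 2 - ∑ i, ∑ j, pderiv j (pderiv i u) x ^ 2)
      + u x * (((n : ℝ) - 1) / 4 * (∑ i, pderiv i u x ^ 2) * ∑ i, pderiv i (pderiv i u) x
        + ((n : ℝ) + 1) / 4 * ∑ i, ∑ j, pderiv i u x * pderiv j u x * pderiv j (pderiv i u) x) := by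
  have h4 : (4 : ℝ) ≤ n := by exact_mod_cast hn
  have h3 : (n : ℝ) - 3 ≠ 0 := by linarith
  have hl : 0 < u x ^ (8 / ((n : ℝ) - 3)) := Real.rpow_pos_of_pos hx _
  have h16 : u x ^ (16 / ((n : ℝ) - 3)) = (u x ^ (8 / ((n : ℝ) - 3))) ^ 2 := by
    rw [← Real.rpow_natCast, ← Real.rpow_mul hx.le]; congr 1; push_cast; ring
  have hs := sigma2Curv_conformal (lam := fun y => u y ^ (8 / ((n : ℝ) - 3))) (x := x) hl.ne'
  change sigma2Curv (confMetric n u) x = (u x ^ (8 / ((n : ℝ) - 3)))⁻¹ ^ 2 * ((1 / 2) *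
    ((∑ i, schouten (confMetric n u) i i x) ^ 2 -
      ∑ i, ∑ j, schouten (confMetric n u) i j x ^ 2)) at hs
  rw [L4, hs, h16]
  simp only [schouten_confMetric hn hu hx, mul_pow, ← Finset.mul_sum, mul_div_assoc,
    sum_schoutenForm_diag, sum_schoutenForm_sq]
  field_simp
  ring

/-- The mean curvature scales like λ^{-1/2} and the tangential trace of P like λ⁻¹, so H₂ scales
like u^{-12/(n-3)}. Moreover H of the metric is H(u)/(ku) up to this scaling. -/
lemma B3_eq (hn : 4 ≤ n) (hu : ContDiff ℝ ∞ u) (hx : 0 < u x) (hx1 : ‖x‖ = 1) :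
    B3 n u x = meanH n u x * (-(((n : ℝ) - 3) / 4 * u x) * (∑ i, pderiv i (pderiv i u) x
          - ∑ i, ∑ j, x i * x j * pderiv j (pderiv i u) x)
        - ((n : ℝ) - 1) / 4 * (∑ i, pderiv i u x ^ 2)
        - ((n : ℝ) + 1) / 4 * (∑ i, x i * pderiv i u x) ^ 2)
      + (n : ℝ) / 3 * meanH n u x ^ 3 := by
  have h4 : (4 : ℝ) ≤ n := by exact_mod_cast hn
  have h3 : (n : ℝ) - 3 ≠ 0 := by linarith
  have hl : 0 < u x ^ (8 / ((n : ℝ) - 3)) := Real.rpow_pos_of_pos hx _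
  have hl4 : 0 < u x ^ (4 / ((n : ℝ) - 3)) := Real.rpow_pos_of_pos hx _
  have h8 : u x ^ (8 / ((n : ℝ) - 3)) = (u x ^ (4 / ((n : ℝ) - 3))) ^ 2 := by
    rw [← Real.rpow_natCast, ← Real.rpow_mul hx.le]; congr 1; push_cast; ring
  have h12 : u x ^ (12 / ((n : ℝ) - 3)) = (u x ^ (4 / ((n : ℝ) - 3))) ^ 3 := by
    rw [← Real.rpow_natCast, ← Real.rpow_mul hx.le]; congr 1; push_cast; ring
  have hsum : ∑ j, x j ^ 2 = 1 := by rw [sum_sq_coord, hx1]; norm_num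
  have hpos := eventually_pos hu hx
  have hmc := meanCurv_conformal (lam := fun y => u y ^ (8 / ((n : ℝ) - 3)))
    (a := fun i y => 4 / ((n : ℝ) - 3) * (pderiv i u y / u y)) (x := x) (by lia)
    (hpos.mono fun y hy => (Real.rpow_pos_of_pos hy _))
    (hpos.mono fun y hy i => pderiv_conformalFactor hn hu hy i)
    ((hu.differentiable (by simp) x).rpow_const (Or.inl hx.ne')) hx1
  have htt := fun A => tangentialTrace_conformal (lam := fun y => u y ^ (8 / ((n : ℝ) - 3)))
    (x := x) hl hx1 A
  change meanCurv (confMetric n u) x = (√(u x ^ (8 / ((n : ℝ) - 3))))⁻¹ * _ at hmc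
  change ∀ A, tangentialTrace (confMetric n u) A x = (u x ^ (8 / ((n : ℝ) - 3)))⁻¹ * _ at htt
  rw [h8, Real.sqrt_sq hl4.le] at hmc
  have hm : meanCurv (confMetric n u) x =
      (u x ^ (4 / ((n : ℝ) - 3)))⁻¹ * ((((n : ℝ) - 3) / 4 * u x)⁻¹ * meanH n u x) := by
    rw [hmc, meanH, fderiv_eq_sum]
    have : ∀ k, 4 / ((n : ℝ) - 3) * (pderiv k u x / u x) * x k =
      4 / ((n : ℝ) - 3) / u x * (x k * pderiv k u x) := by intro k; ring
    rw [Finset.sum_congr rfl fun k _ => this k, ← Finset.mul_sum]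
    field_simp
    ring
  rw [B3, H2Curv, htt, hm, h12, h8]
  have hc : ∀ c E : ℝ, ∀ i j, x i * x j * (c * E) = c * (x i * x j * E) := by intros; ring
  simp only [schouten_confMetric hn hu hx, hc, ← Finset.mul_sum, mul_div_assoc,
    sum_schoutenForm_diag, sum_schoutenForm_contract, hsum]
  push_cast
  field_simp
  ring

end ConfMetric

/-! ### Polar coordinates and the divergence theorem on the unit ball. -/

section Divergence

variable {n : ℕ}

instance : IsFiniteMeasure (surface n) := by unfold surface; infer_instance

/-- Removing the origin, a null set, makes space homeomorphic to sphere times half-line, with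
Lebesgue measure becoming surface measure times rⁿ dr; Fubini finishes. -/
lemma integral_eq_polar (F : Euc (n + 1) → ℝ) (hF : Integrable F) :
    ∫ x, F x = ∫ r in Set.Ioi (0 : ℝ),
      r ^ n * ∫ t : sphere (0 : Euc (n + 1)) 1, F (r • (t : Euc (n + 1))) ∂surface n := by
  have hmp := (volume : Measure (Euc (n + 1))).measurePreserving_homeomorphUnitSphereProd
  have hemb := (homeomorphUnitSphereProd (Euc (n + 1))).measurableEmbedding
  have hfin : Module.finrank ℝ (Euc (n + 1)) - 1 = n := by simp
  rw [hfin] at hmp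
  change MeasurePreserving _ _ ((surface n).prod (Measure.volumeIoiPow n)) at hmp
  set G : sphere (0 : Euc (n + 1)) 1 × Set.Ioi (0 : ℝ) → ℝ :=
    fun p => F ((p.2 : ℝ) • (p.1 : Euc (n + 1))) with hG
  have hGF : ∀ x : ({0}ᶜ : Set (Euc (n + 1))), G (homeomorphUnitSphereProd _ x) = F x := by
    intro x
    have hx : ‖(x : Euc (n + 1))‖ ≠ 0 := norm_ne_zero_iff.2 x.2
    simp only [hG, homeomorphUnitSphereProd_apply_snd_coe, homeomorphUnitSphereProd_apply_fst_coe]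
    rw [smul_smul, mul_inv_cancel₀ hx, one_smul]
  have hGi : Integrable G ((surface n).prod (Measure.volumeIoiPow n)) := by
    rw [← hmp.integrable_comp_emb hemb]
    have : G ∘ (homeomorphUnitSphereProd (Euc (n + 1))) = F ∘ Subtype.val := funext hGF
    rw [this, ← (MeasurableEmbedding.subtype_coe
      (measurableSet_singleton (0 : Euc (n + 1))).compl).integrableOn_range_iff_comap]
    exact hF.integrableOn
  calc
    ∫ x, F x = ∫ x : ({0}ᶜ : Set (Euc (n + 1))), F x ∂(Measure.comap Subtype.val volume) := by
      rw [integral_subtype_comap (measurableSet_singleton _).compl F, restrict_compl_singleton]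
    _ = ∫ p, G p ∂(surface n).prod (Measure.volumeIoiPow n) := by
      rw [← hmp.integral_comp hemb]
      simp only [hGF]
    _ = ∫ r : Set.Ioi (0 : ℝ), (∫ t, G (t, r) ∂surface n) ∂Measure.volumeIoiPow n :=
      integral_prod_symm _ hGi
    _ = _ := by
      simp only [Measure.volumeIoiPow, ENNReal.ofReal]
      rw [integral_withDensity_eq_integral_smul,
        integral_subtype_comap measurableSet_Ioi fun r =>
          Real.toNNReal (r ^ n) • ∫ t : sphere (0 : Euc (n + 1)) 1, F (r • (t : Euc (n + 1))) ∂surface n,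
        setIntegral_congr_fun measurableSet_Ioi fun r hr => ?_]
      · simp only [NNReal.smul_def, Real.coe_toNNReal _ (pow_nonneg (le_of_lt hr) _), smul_eq_mul]
      · exact (measurable_subtype_coe.pow_const _).real_toNNReal

lemma continuous_sphereIntegral {F : ℝ → Euc (n + 1) → ℝ} (hF : Continuous (Function.uncurry F)) :
    Continuous fun r : ℝ => ∫ t : sphere (0 : Euc (n + 1)) 1, F r t ∂surface n := by
  have := continuous_parametric_integral_of_continuous (μ := surface n)
    (f := fun (r : ℝ) (t : sphere (0 : Euc (n + 1)) 1) => F r t)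
    (by fun_prop) isCompact_univ
  simpa using this

lemma integrable_sphere {F : Euc (n + 1) → ℝ} (hF : Continuous F) :
    Integrable (fun t : sphere (0 : Euc (n + 1)) 1 => F t) (surface n) :=
  (hF.comp continuous_subtype_val).integrable_of_hasCompactSupport
    (HasCompactSupport.of_compactSpace _)

lemma integrableOn_ball {F : Euc (n + 1) → ℝ} (hF : Continuous F) (R : ℝ) :
    IntegrableOn F (closedBall 0 R) :=
  hF.continuousOn.integrableOn_compact (isCompact_closedBall _ _)

/-- Polar coordinates for `G(|x|) F(x)` with a radial factor `G` that vanishes beyond `R`. -/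
lemma integral_radial_mul {F : Euc (n + 1) → ℝ} {G : ℝ → ℝ}
    {R : ℝ} (hR : 0 ≤ R) (hG : ∀ r, R < r → G r = 0)
    (hi : Integrable (fun x : Euc (n + 1) => G ‖x‖ * F x)) :
    ∫ x : Euc (n + 1), G ‖x‖ * F x = ∫ r in (0 : ℝ)..R, G r *
      (r ^ n * ∫ t : sphere (0 : Euc (n + 1)) 1, F (r • (t : Euc (n + 1))) ∂surface n) := by
  rw [integral_eq_polar _ hi, intervalIntegral.integral_of_le hR,
    ← setIntegral_eq_of_subset_of_forall_sdiff_eq_zero measurableSet_Ioi Set.Ioc_subset_Ioi_self]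
  · refine setIntegral_congr_fun measurableSet_Ioi fun r hr => ?_
    have hr0 : (0 : ℝ) < r := hr
    have : ∀ t : sphere (0 : Euc (n + 1)) 1, ‖r • (t : Euc (n + 1))‖ = r := by
      intro t; rw [norm_smul, norm_eq_of_mem_sphere t]; simp [abs_of_pos hr0]
    simp only [this, integral_const_mul]
    ring
  · intro r hr
    have : R < r := by
      by_contra hc
      exact hr.2 ⟨hr.1, not_lt.1 hc⟩
    simp [hG r this]

lemma integral_ball_eq_polar {F : Euc (n + 1) → ℝ} (hF : Continuous F) {R : ℝ} (hR : 0 ≤ R) :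
    ∫ x in closedBall (0 : Euc (n + 1)) R, F x = ∫ r in (0 : ℝ)..R,
      r ^ n * ∫ t : sphere (0 : Euc (n + 1)) 1, F (r • (t : Euc (n + 1))) ∂surface n := by
  have e : ∀ x : Euc (n + 1), (closedBall (0 : Euc (n + 1)) R).indicator F x =
      (Set.Iic R).indicator (fun _ => (1 : ℝ)) ‖x‖ * F x := by
    intro x
    by_cases h : ‖x‖ ≤ R <;> simp [Set.indicator, h]
  rw [← integral_indicator measurableSet_closedBall]
  simp only [e]
  rw [integral_radial_mul hR]
  · refine intervalIntegral.integral_congr fun r hr => ?_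
    rw [Set.uIcc_of_le hR] at hr
    simp [hr.2]
  · intro r hr
    simp [hr]
  · simp only [← e]
    exact (integrableOn_ball hF R).integrable_indicator measurableSet_closedBall

/-- Squaring the positive part makes it C¹ across 0. Both the compactly supported weight below and
the later cutoff step are built from this function. -/
lemma hasDerivAt_max_sq (t : ℝ) : HasDerivAt (fun s : ℝ => max s 0 ^ 2) (2 * max t 0) t := by
  rcases lt_trichotomy t 0 with h | h | h
  · rw [max_eq_right h.le]
    have : (fun s : ℝ => max s 0 ^ 2) =ᶠ[nhds t] fun _ => 0 := by
      filter_upwards [gt_mem_nhds h] with s hs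
      simp [max_eq_right hs.le]
    simpa using (hasDerivAt_const t (0 : ℝ)).congr_of_eventuallyEq this
  · subst h
    rw [hasDerivAt_iff_isLittleO]
    have : (fun s : ℝ => max s 0 ^ 2) =O[nhds 0] fun s : ℝ => s ^ 2 := by
      refine Asymptotics.IsBigO.of_bound 1 (Filter.Eventually.of_forall fun s => ?_)
      rw [one_mul, norm_pow, norm_pow, Real.norm_eq_abs, Real.norm_eq_abs]
      refine pow_le_pow_left₀ (abs_nonneg _) ?_ 2
      rcases le_total s 0 with hs | hs
      · rw [max_eq_right hs, abs_zero]; exact abs_nonneg s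
      · rw [max_eq_left hs]
    have h2 : (fun s : ℝ => s ^ 2) =o[nhds 0] fun s : ℝ => s := by
      simpa using Asymptotics.isLittleO_pow_id (𝕜 := ℝ) one_lt_two
    simpa using this.trans_isLittleO h2
  · rw [max_eq_left h.le]
    have : (fun s : ℝ => max s 0 ^ 2) =ᶠ[nhds t] fun s => s ^ 2 := by
      filter_upwards [lt_mem_nhds h] with s hs
      simp [max_eq_left hs.le]
    simpa using (hasDerivAt_pow 2 t).congr_of_eventuallyEq this

lemma contDiff_max_sq : ContDiff ℝ 1 (fun s : ℝ => max s 0 ^ 2) := by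
  rw [contDiff_one_iff_deriv]
  refine ⟨fun t => (hasDerivAt_max_sq t).differentiableAt, ?_⟩
  rw [show deriv (fun s : ℝ => max s 0 ^ 2) = fun t => 2 * max t 0 from
    funext fun t => (hasDerivAt_max_sq t).deriv]
  fun_prop

lemma pderiv_norm_sq (i : Fin (n + 1)) (x : Euc (n + 1)) :
    pderiv i (fun y => ‖y‖ ^ 2) x = 2 * x i := by
  have e : (fun y : Euc (n + 1) => ‖y‖ ^ 2) = fun y => ∑ j, y j ^ 2 := by
    funext y; rw [sum_sq_coord]
  rw [e, pderiv_sum _ (fun j (y : Euc (n + 1)) => y j ^ 2) _ fun j _ => (differentiable_coord j x).pow 2]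
  simp only [pderiv_pow i 2 (differentiable_coord _ x), pderiv_coord]
  simp

/-- Testing the divergence of a field against the weight `(R² - |x|²)₊²`. -/
lemma integral_weighted_pderiv {f : Euc (n + 1) → ℝ} (hf : ContDiff ℝ 1 f) (i : Fin (n + 1))
    {R : ℝ} (hR : 0 ≤ R) :
    ∫ r in (0 : ℝ)..R, (R ^ 2 - r ^ 2) ^ 2 * (r ^ n *
        ∫ t : sphere (0 : Euc (n + 1)) 1, pderiv i f (r • (t : Euc (n + 1))) ∂surface n) =
      4 * ∫ r in (0 : ℝ)..R, (R ^ 2 - r ^ 2) * r * (r ^ n *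
        ∫ t : sphere (0 : Euc (n + 1)) 1,
          (t : Euc (n + 1)) i * f (r • (t : Euc (n + 1))) ∂surface n) := by
  set w : Euc (n + 1) → ℝ := fun x => max (R ^ 2 - ‖x‖ ^ 2) 0 ^ 2 with hw
  have hns : ContDiff ℝ 1 (fun x : Euc (n + 1) => R ^ 2 - ‖x‖ ^ 2) :=
    contDiff_const.sub (contDiff_norm_sq ℝ)
  have hwd : ContDiff ℝ 1 w := contDiff_max_sq.comp hns
  have hz : ∀ r, R < r → max (R ^ 2 - r ^ 2) 0 = 0 := by
    intro r hr; apply max_eq_right; nlinarith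
  have hpw : ∀ x, fderiv ℝ w x (EuclideanSpace.single i 1) =
      -4 * max (R ^ 2 - ‖x‖ ^ 2) 0 * x i := by
    intro x
    change pderiv i w x = _
    rw [hw, pderiv_comp (φ := fun s : ℝ => max s 0 ^ 2) i (hasDerivAt_max_sq _)
      (hns.differentiable one_ne_zero x), pderiv_sub i (differentiableAt_const _)
      ((contDiff_norm_sq ℝ (n := 1)).differentiable one_ne_zero x), pderiv_const, pderiv_norm_sq]
    ring
  have hcs : ∀ G : ℝ → ℝ, (∀ r, R < r → G r = 0) → ∀ F : Euc (n + 1) → ℝ,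
      HasCompactSupport (fun x => G ‖x‖ * F x) := by
    intro G hG F
    refine HasCompactSupport.of_support_subset_isCompact (isCompact_closedBall 0 R) ?_
    intro x hx
    by_contra hc
    refine hx ?_
    simp only [mem_closedBall, dist_zero_right, not_le] at hc
    simp [hG _ hc]
  have hcw := hwd.continuous
  have hcf := hf.continuous
  have hcp := continuous_pderiv i hf
  have hci : Continuous fun x : Euc (n + 1) => x i := (differentiable_coord i).continuous
  have i1 : Integrable (fun x => max (R ^ 2 - ‖x‖ ^ 2) 0 ^ 2 * pderiv i f x) :=
    (Continuous.mul hcw hcp).integrable_of_hasCompactSupport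
      (hcs (fun r => max (R ^ 2 - r ^ 2) 0 ^ 2) (fun r hr => by simp [hz r hr]) _)
  have i2 : Integrable (fun x => max (R ^ 2 - ‖x‖ ^ 2) 0 * (x i * f x)) :=
    Continuous.integrable_of_hasCompactSupport (by fun_prop)
      (hcs (fun r => max (R ^ 2 - r ^ 2) 0) (fun r hr => by simp [hz r hr]) _)
  have i3 : Integrable (fun x => max (R ^ 2 - ‖x‖ ^ 2) 0 ^ 2 * f x) :=
    (Continuous.mul hcw hcf).integrable_of_hasCompactSupport
      (hcs (fun r => max (R ^ 2 - r ^ 2) 0 ^ 2) (fun r hr => by simp [hz r hr]) _)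
  -- The weight is C¹ and supported in the ball of radius R, so integration by parts over the whole
  -- space has no boundary term. Its gradient is −4(R² − |x|²)₊ x.
  have key := integral_mul_fderiv_eq_neg_fderiv_mul_of_integrable (μ := volume) (f := w) (g := f)
    (v := EuclideanSpace.single i 1)
    (by
      simp only [hpw]
      refine (i2.const_mul (-4)).congr (Filter.Eventually.of_forall fun x => ?_)
      ring) i1 i3
    (fun x _ => hwd.differentiable one_ne_zero x) (fun x _ => hf.differentiable one_ne_zero x)
  simp only [hpw] at key
  have e2 : ∀ x : Euc (n + 1), -4 * max (R ^ 2 - ‖x‖ ^ 2) 0 * x i * f x =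
    -4 * (max (R ^ 2 - ‖x‖ ^ 2) 0 * (x i * f x)) := by intro x; ring
  simp only [e2, integral_const_mul] at key
  rw [integral_radial_mul (F := fun x => x i * f x) (G := fun r => max (R ^ 2 - r ^ 2) 0)
    hR hz i2] at key
  have k1 := integral_radial_mul (F := pderiv i f) (G := fun r => max (R ^ 2 - r ^ 2) 0 ^ 2)
    hR (fun r hr => by simp [hz r hr]) i1
  have k2 := key.symm.trans k1
  clear key
  have hmax : ∀ r ∈ Set.uIcc 0 R, max (R ^ 2 - r ^ 2) 0 = R ^ 2 - r ^ 2 := by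
    intro r hr
    rw [Set.uIcc_of_le hR] at hr
    apply max_eq_left
    nlinarith [hr.1, hr.2]
  refine (intervalIntegral.integral_congr fun r hr => ?_).trans (k2.symm.trans ?_)
  · simp only [hmax r hr]
  · rw [neg_mul, neg_neg]
    congr 1
    refine intervalIntegral.integral_congr fun r hr => ?_
    simp only [hmax r hr, PiLp.smul_apply, smul_eq_mul, mul_assoc, integral_const_mul]
    ring

/-- If `∫₀ᴿ (R² - r²)² α = 4 ∫₀ᴿ (R² - r²) r β` for all `R > 0`, then `β` is the primitive
of `α` that vanishes at `0`. -/
lemma eq_integral_of_weighted {al be : ℝ → ℝ} (ha : Continuous al) (hb : Continuous be)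
    (h : ∀ R, 0 < R → ∫ r in (0 : ℝ)..R, (R ^ 2 - r ^ 2) ^ 2 * al r =
      4 * ∫ r in (0 : ℝ)..R, (R ^ 2 - r ^ 2) * r * be r) {R : ℝ} (hR : 0 < R) :
    ∫ r in (0 : ℝ)..R, al r = be R := by
  set A : ℝ → ℝ := fun r => ∫ s in (0 : ℝ)..r, al s with hA
  have hAd : ∀ r, HasDerivAt A (al r) r := fun r =>
    intervalIntegral.integral_hasDerivAt_right (ha.intervalIntegrable _ _)
      ha.aestronglyMeasurable.stronglyMeasurableAtFilter ha.continuousAt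
  have hAc : Continuous A := continuous_iff_continuousAt.2 fun r => (hAd r).continuousAt
  -- Integrating the hypothesis by parts gives ∫₀ᴿ (R² − r²)γ = 0 for all R > 0. Differentiating in
  -- R gives 2R∫₀ᴿ γ = 0, and once more gives γ(R) = 0.
  set γ : ℝ → ℝ := fun r => r * (A r - be r) with hγ
  have hγc : Continuous γ := by fun_prop
  have hprim : ∀ f : ℝ → ℝ, Continuous f → ∀ r,
      HasDerivAt (fun r => ∫ s in (0 : ℝ)..r, f s) (f r) r := fun f hf r =>
    intervalIntegral.integral_hasDerivAt_right (hf.intervalIntegrable _ _)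
      hf.aestronglyMeasurable.stronglyMeasurableAtFilter hf.continuousAt
  have h1 : ∀ R, 0 < R → R ^ 2 * (∫ r in (0 : ℝ)..R, γ r) - ∫ r in (0 : ℝ)..R, r ^ 2 * γ r = 0 := by
    intro R hR
    have hibp : ∫ r in (0 : ℝ)..R, (R ^ 2 - r ^ 2) ^ 2 * al r =
        (R ^ 2 - R ^ 2) ^ 2 * A R - (R ^ 2 - 0 ^ 2) ^ 2 * A 0 -
          ∫ r in (0 : ℝ)..R, (-4 * ((R ^ 2 - r ^ 2) * r)) * A r := by
      refine intervalIntegral.integral_mul_deriv_eq_deriv_mul (u := fun r => (R ^ 2 - r ^ 2) ^ 2)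
        (v := A) (fun r _ => ?_) (fun r _ => hAd r)
        (Continuous.intervalIntegrable (by fun_prop) _ _) (ha.intervalIntegrable _ _)
      have := (((hasDerivAt_pow 2 r).const_sub (R ^ 2)).fun_pow 2)
      convert! this using 1
      push_cast; ring
    have hA0 : A 0 = 0 := by simp [hA]
    have e1 : ∫ r in (0 : ℝ)..R, (-4 * ((R ^ 2 - r ^ 2) * r)) * A r =
        -4 * ∫ r in (0 : ℝ)..R, (R ^ 2 - r ^ 2) * r * A r := by
      rw [← intervalIntegral.integral_const_mul]; simp only [mul_assoc]
    have h' := h R hR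
    rw [hibp, hA0, e1] at h'
    rw [← intervalIntegral.integral_const_mul, ← intervalIntegral.integral_sub
      (Continuous.intervalIntegrable (by fun_prop) _ _)
      (Continuous.intervalIntegrable (by fun_prop) _ _)]
    have e2 : ∀ r, R ^ 2 * γ r - r ^ 2 * γ r =
      (R ^ 2 - r ^ 2) * r * A r - (R ^ 2 - r ^ 2) * r * be r := by intro r; simp only [hγ]; ring
    simp only [e2]
    rw [intervalIntegral.integral_sub
      (Continuous.intervalIntegrable (by fun_prop) _ _)
      (Continuous.intervalIntegrable (by fun_prop) _ _)]
    linarith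
  have h2 : ∀ R, 0 < R → ∫ r in (0 : ℝ)..R, γ r = 0 := by
    intro R hR
    have hd := ((hasDerivAt_pow 2 R).mul (hprim γ hγc R)).sub
      (hprim (fun r => r ^ 2 * γ r) (by fun_prop) R)
    have hz : HasDerivAt (fun _ : ℝ => (0 : ℝ)) 0 R := hasDerivAt_const R 0
    have heq := hd.unique (hz.congr_of_eventuallyEq (by
      filter_upwards [lt_mem_nhds hR] with r hr
      exact h1 r hr))
    push_cast at heq
    have : 2 * R * ∫ r in (0 : ℝ)..R, γ r = 0 := by linarith
    rcases mul_eq_zero.1 this with h' | h'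
    · linarith
    · exact h'
  have h3 : γ R = 0 := by
    have hz : HasDerivAt (fun _ : ℝ => (0 : ℝ)) 0 R := hasDerivAt_const R 0
    exact (hprim γ hγc R).unique (hz.congr_of_eventuallyEq (by
      filter_upwards [lt_mem_nhds hR] with r hr
      exact h2 r hr))
  rcases mul_eq_zero.1 h3 with h' | h'
  · linarith
  · exact sub_eq_zero.1 h'

/-- The divergence theorem on the unit ball. -/
theorem integral_pderiv_ball {f : Euc (n + 1) → ℝ} (hf : ContDiff ℝ 1 f) (i : Fin (n + 1)) :
    ∫ x in closedBall (0 : Euc (n + 1)) 1, pderiv i f x =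
      ∫ t : sphere (0 : Euc (n + 1)) 1, (t : Euc (n + 1)) i * f t ∂surface n := by
  have hcf := hf.continuous
  have hcp := continuous_pderiv i hf
  have hci : Continuous fun x : Euc (n + 1) => x i := (differentiable_coord i).continuous
  have := eq_integral_of_weighted ((continuous_id.pow n).mul
      (continuous_sphereIntegral (F := fun r t => pderiv i f (r • t)) (by fun_prop)))
      ((continuous_id.pow n).mul
      (continuous_sphereIntegral (F := fun r t => t i * f (r • t)) (by fun_prop)))
      (fun R hR => integral_weighted_pderiv hf i hR.le) one_pos
  rw [integral_ball_eq_polar hcp zero_le_one]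
  simpa using this

end Divergence

/-! ### Integration by parts on the sphere, and the divergences needed for the energy. -/

section Energy

variable {n : ℕ}

lemma integral_divergence_ball {f : Fin (n + 1) → Euc (n + 1) → ℝ}
    (hf : ∀ i, ContDiff ℝ 1 (f i)) :
    ∫ x in closedBall (0 : Euc (n + 1)) 1, ∑ i, pderiv i (f i) x =
      ∫ t : sphere (0 : Euc (n + 1)) 1, ∑ i, (t : Euc (n + 1)) i * f i t ∂surface n := by
  rw [integral_finsetSum _ fun i _ => integrableOn_ball (continuous_pderiv i (hf i)) 1,
    integral_finsetSum]
  · exact Finset.sum_congr rfl fun i _ => integral_pderiv_ball (hf i) i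
  · intro i _
    exact integrable_sphere (F := fun t => t i * f i t)
      ((differentiable_coord i).continuous.mul (hf i).continuous)

/-- The rotation fields `x_i ∂_j - x_j ∂_i` are divergence free on the sphere. -/
lemma integral_sphere_rotation_eq_zero {f : Fin (n + 1) → Fin (n + 1) → Euc (n + 1) → ℝ}
    (hf : ∀ i j, ContDiff ℝ ∞ (f i j)) :
    ∫ t : sphere (0 : Euc (n + 1)) 1, ∑ i, (t : Euc (n + 1)) i *
      ∑ j, (pderiv j (f i j) t - pderiv j (f j i) t) ∂surface n = 0 := by
  have h1 : ∀ i j k, ContDiff ℝ ∞ (pderiv k (f i j)) := fun i j k => contDiff_pderiv k (hf i j)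
  have hd : ∀ i j k, Differentiable ℝ (pderiv k (f i j)) := fun i j k =>
    (h1 i j k).differentiable (by simp)
  -- The field Σ_j ∂_j(f_ij − f_ji) has zero divergence because its potential is antisymmetric and
  -- second derivatives commute. Its flux through the sphere therefore vanishes.
  rw [← integral_divergence_ball
    (f := fun i x => ∑ j, (pderiv j (f i j) x - pderiv j (f j i) x))
    fun i => ContDiff.sum fun j _ => ((h1 i j j).sub (h1 j i j)).of_le (by simp)]
  rw [show (0 : ℝ) = ∫ x in closedBall (0 : Euc (n + 1)) 1, (0 : ℝ) by simp]
  congr 1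
  funext x
  have e : ∀ i, pderiv i (fun x => ∑ j, (pderiv j (f i j) x - pderiv j (f j i) x)) x =
      ∑ j, (pderiv i (pderiv j (f i j)) x - pderiv i (pderiv j (f j i)) x) := by
    intro i
    rw [pderiv_sum _ (fun j x => pderiv j (f i j) x - pderiv j (f j i) x) _
      fun j _ => (hd i j j x).sub (hd j i j x)]
    exact Finset.sum_congr rfl fun j _ => pderiv_sub i (hd i j j x) (hd j i j x)
  rw [Finset.sum_congr rfl fun i _ => e i]
  simp only [Finset.sum_sub_distrib]
  rw [sub_eq_zero, Finset.sum_comm]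
  exact Finset.sum_congr rfl fun i _ => Finset.sum_congr rfl fun j _ => pderiv_comm j i (hf j i)

/-- Integration by parts on the sphere: `∮ (⟨∇'ψ, ∇'u⟩ + ψ Δ'u) = 0`, where `∇'`, `Δ'` are the
tangential gradient and Laplacian. -/
lemma integral_sphere_tangential_ibp {psi u : Euc (n + 1) → ℝ} (hp : ContDiff ℝ ∞ psi)
    (hu : ContDiff ℝ ∞ u) :
    ∫ t : sphere (0 : Euc (n + 1)) 1, ((∑ j, pderiv j psi t * pderiv j u t)
      - (∑ j, (t : Euc (n + 1)) j * pderiv j psi t) * (∑ i, (t : Euc (n + 1)) i * pderiv i u t)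
      + psi t * (∑ j, pderiv j (pderiv j u) t
        - ∑ i, ∑ j, (t : Euc (n + 1)) i * (t : Euc (n + 1)) j * pderiv j (pderiv i u) t
        - n * ∑ i, (t : Euc (n + 1)) i * pderiv i u t)) ∂surface n = 0 := by
  have hV : ∀ i, ContDiff ℝ ∞ (pderiv i u) := fun i => contDiff_pderiv i hu
  -- With potential ψ x_i ∂_j u, the derivative of x_i produces the first-order term −n ψ ηu, while
  -- |x| = 1 turns the rest into tangential parts.
  rw [← integral_sphere_rotation_eq_zero (f := fun i j x => psi x * (x i * pderiv j u x))
    fun i j => hp.mul ((contDiff_coord i).mul (hV j))]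
  congr 1
  funext t
  obtain ⟨x, hx⟩ := t
  have hx1 : ∑ i, x i ^ 2 = 1 := by
    rw [sum_sq_coord, mem_sphere_zero_iff_norm.1 hx]; norm_num
  have e : ∀ i j k, pderiv k (fun x => psi x * (x i * pderiv j u x)) x =
      pderiv k psi x * (x i * pderiv j u x)
        + psi x * (kron k i * pderiv j u x + x i * pderiv k (pderiv j u) x) := by
    intro i j k
    have d1 := (differentiable_coord i) x
    have d2 := (hV j).differentiable (by simp) x
    rw [pderiv_mul k (hp.differentiable (by simp) x) (d1.fun_mul d2), pderiv_mul k d1 d2,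
      pderiv_coord]
    rfl
  simp only [e]
  have e1 : ∀ i j, x i * (pderiv j psi x * (x i * pderiv j u x) + psi x * (kron j i * pderiv j u x +
      x i * pderiv j (pderiv j u) x) - (pderiv j psi x * (x j * pderiv i u x) +
      psi x * (kron j j * pderiv i u x + x j * pderiv j (pderiv i u) x))) =
      x i ^ 2 * (pderiv j psi x * pderiv j u x + psi x * pderiv j (pderiv j u) x)
      + kron j i * (psi x * (x i * pderiv j u x))
      - (x i * pderiv i u x) * (x j * pderiv j psi x + psi x)
      - psi x * (x i * x j * pderiv j (pderiv i u) x) := by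
    intro i j; rw [kron_self]; ring
  simp only [Finset.mul_sum, e1]
  simp only [Finset.sum_sub_distrib, Finset.sum_add_distrib, ← Finset.mul_sum, ← Finset.sum_mul,
    hx1, sum_kron_mul', Finset.sum_const, Finset.card_univ, Fintype.card_fin, nsmul_eq_mul]
  push_cast
  ring

variable {u : Euc (n + 1) → ℝ}

/-- The field `(u²/2)(Δu ∇u - ∇²u ∇u)` whose divergence contains `u² σ₂(∇²u)`. -/
lemma divergence_newton (hu : ContDiff ℝ ∞ u) (x : Euc (n + 1)) :
    ∑ i, pderiv i (fun x => u x ^ 2 * ∑ j, (pderiv j (pderiv j u) x * pderiv i u x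
        - pderiv j (pderiv i u) x * pderiv j u x)) x =
      2 * u x * ((∑ i, pderiv i u x ^ 2) * ∑ i, pderiv i (pderiv i u) x
        - ∑ i, ∑ j, pderiv i u x * pderiv j u x * pderiv j (pderiv i u) x)
      + u x ^ 2 * ((∑ i, pderiv i (pderiv i u) x) ^ 2
        - ∑ i, ∑ j, pderiv j (pderiv i u) x ^ 2) := by
  have hV : ∀ i, ContDiff ℝ ∞ (pderiv i u) := fun i => contDiff_pderiv i hu
  have hD : ∀ i j, ContDiff ℝ ∞ (pderiv j (pderiv i u)) := fun i j => contDiff_pderiv j (hV i)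
  have du := hu.differentiable (by simp) x
  have dV : ∀ i, DifferentiableAt ℝ (pderiv i u) x := fun i => (hV i).differentiable (by simp) x
  have dD : ∀ i j, DifferentiableAt ℝ (pderiv j (pderiv i u)) x :=
    fun i j => (hD i j).differentiable (by simp) x
  have dT : ∀ i j, DifferentiableAt ℝ (fun x => pderiv j (pderiv j u) x * pderiv i u x
        - pderiv j (pderiv i u) x * pderiv j u x) x := fun i j =>
    ((dD j j).fun_mul (dV i)).fun_sub ((dD i j).fun_mul (dV j))
  have e : ∀ i, pderiv i (fun x => u x ^ 2 * ∑ j, (pderiv j (pderiv j u) x * pderiv i u x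
        - pderiv j (pderiv i u) x * pderiv j u x)) x =
      ∑ j, (2 * u x * (pderiv i u x ^ 2 * pderiv j (pderiv j u) x
        - pderiv i u x * pderiv j u x * pderiv j (pderiv i u) x)
      + u x ^ 2 * (pderiv i (pderiv j (pderiv j u)) x * pderiv i u x
        + pderiv j (pderiv j u) x * pderiv i (pderiv i u) x
        - pderiv j (pderiv i (pderiv i u)) x * pderiv j u x
        - pderiv j (pderiv i u) x ^ 2)) := by
    intro i
    rw [pderiv_mul i (du.fun_pow 2) (DifferentiableAt.fun_sum fun j _ => dT i j),
      pderiv_pow i 2 du, pderiv_sum _ (fun j x => pderiv j (pderiv j u) x * pderiv i u x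
        - pderiv j (pderiv i u) x * pderiv j u x) _ fun j _ => dT i j, Finset.mul_sum,
      Finset.mul_sum, ← Finset.sum_add_distrib]
    refine Finset.sum_congr rfl fun j _ => ?_
    rw [pderiv_sub i ((dD j j).fun_mul (dV i)) ((dD i j).fun_mul (dV j)),
      pderiv_mul i (dD j j) (dV i), pderiv_mul i (dD i j) (dV j),
      pderiv_comm i j (hV i), show pderiv i (pderiv j u) x = pderiv j (pderiv i u) x from
        pderiv_comm i j hu]
    push_cast
    ring
  rw [Finset.sum_congr rfl fun i _ => e i]
  simp only [Finset.sum_sub_distrib, Finset.sum_add_distrib, ← Finset.mul_sum]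
  rw [show ∑ i, ∑ j, pderiv i (pderiv j (pderiv j u)) x * pderiv i u x =
    ∑ i, ∑ j, pderiv j (pderiv i (pderiv i u)) x * pderiv j u x from Finset.sum_comm]
  simp only [← Finset.mul_sum, ← Finset.sum_mul]
  ring

/-- Together with the Newton field, this divergence absorbs the Hessian terms of u L₄ that are not
of the form |∇u|² Δu. -/
lemma divergence_gradientCube (hu : ContDiff ℝ ∞ u) (x : Euc (n + 1)) :
    ∑ i, pderiv i (fun x => u x * (∑ j, pderiv j u x ^ 2) * pderiv i u x) x =
      (∑ i, pderiv i u x ^ 2) ^ 2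
      + 2 * u x * (∑ i, ∑ j, pderiv i u x * pderiv j u x * pderiv j (pderiv i u) x)
      + u x * (∑ i, pderiv i u x ^ 2) * ∑ i, pderiv i (pderiv i u) x := by
  have hV : ∀ i, ContDiff ℝ ∞ (pderiv i u) := fun i => contDiff_pderiv i hu
  have du := hu.differentiable (by simp) x
  have dV : ∀ i, DifferentiableAt ℝ (pderiv i u) x := fun i => (hV i).differentiable (by simp) x
  have dS : DifferentiableAt ℝ (fun x => ∑ j, pderiv j u x ^ 2) x :=
    DifferentiableAt.fun_sum fun j _ => (dV j).fun_pow 2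
  have e : ∀ i, pderiv i (fun x => u x * (∑ j, pderiv j u x ^ 2) * pderiv i u x) x =
      (∑ j, pderiv j u x ^ 2) * pderiv i u x ^ 2
      + 2 * u x * (∑ j, pderiv i u x * pderiv j u x * pderiv j (pderiv i u) x)
      + u x * (∑ j, pderiv j u x ^ 2) * pderiv i (pderiv i u) x := by
    intro i
    rw [pderiv_mul i (du.fun_mul dS) (dV i), pderiv_mul i du dS,
      pderiv_sum _ (fun j x => pderiv j u x ^ 2) _ fun j _ => (dV j).fun_pow 2]
    simp only [pderiv_pow i 2 (dV _), pderiv_comm i _ hu, mul_assoc, ← Finset.mul_sum]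
    push_cast
    have : ∑ j, pderiv j u x ^ (2 - 1) * pderiv j (pderiv i u) x =
      ∑ j, pderiv j u x * pderiv j (pderiv i u) x := by simp
    rw [this]
    ring
  simp only [e, Finset.sum_add_distrib, ← Finset.mul_sum]
  ring

/-- The differentiated function is the multiplier ψ of the boundary integration by parts. Its first
coefficient k/2 cancels ∇²u(x, ∇u) from the Newton flux; the second, k², is then forced by the Δu
term of `B3`, and ∇²u(x, x) drops out as well. -/
lemma pderiv_ibpTest (hu : ContDiff ℝ ∞ u) (k : ℝ) (x : Euc (n + 1)) (j : Fin (n + 1)) :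
    pderiv j (fun x => k / 2 * (u x ^ 2 * ∑ i, x i * pderiv i u x) + k ^ 2 * u x ^ 3) x =
      k / 2 * (2 * u x * (∑ i, x i * pderiv i u x) * pderiv j u x
        + u x ^ 2 * (pderiv j u x + ∑ i, x i * pderiv j (pderiv i u) x))
      + 3 * k ^ 2 * u x ^ 2 * pderiv j u x := by
  have hV : ∀ i, ContDiff ℝ ∞ (pderiv i u) := fun i => contDiff_pderiv i hu
  have du := hu.differentiable (by simp) x
  have dx := fun i : Fin (n + 1) => differentiable_coord i x
  have dV : ∀ i, DifferentiableAt ℝ (pderiv i u) x := fun i => (hV i).differentiable (by simp) x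
  have dS : DifferentiableAt ℝ (fun x : Euc (n + 1) => ∑ i, x i * pderiv i u x) x :=
    DifferentiableAt.fun_sum fun j _ => (dx j).fun_mul (dV j)
  rw [pderiv_add j (((du.fun_pow 2).fun_mul dS).const_mul _) ((du.fun_pow 3).const_mul _),
    pderiv_const_mul j _ ((du.fun_pow 2).fun_mul dS), pderiv_const_mul j _ (du.fun_pow 3),
    pderiv_mul j (du.fun_pow 2) dS, pderiv_pow j 2 du, pderiv_pow j 3 du,
    pderiv_sum _ (fun i (x : Euc (n + 1)) => x i * pderiv i u x) _
      fun i _ => (dx i).fun_mul (dV i)]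
  have : ∀ i, pderiv j (fun x : Euc (n + 1) => x i * pderiv i u x) x =
      kron j i * pderiv i u x + x i * pderiv j (pderiv i u) x := by
    intro i
    rw [pderiv_mul j (dx i) (dV i), pderiv_coord]; rfl
  simp only [this, Finset.sum_add_distrib, sum_kron_mul]
  push_cast
  ring

end Energy

/-! ### The energy identity and coercivity on the cone. -/

section EnergyIdentity

variable {n : ℕ} {u : Euc (n + 1) → ℝ}

lemma sum_x_newton (x : Euc (n + 1)) :
    ∑ i, x i * (u x ^ 2 * ∑ j, (pderiv j (pderiv j u) x * pderiv i u x
        - pderiv j (pderiv i u) x * pderiv j u x)) =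
      u x ^ 2 * ((∑ i, pderiv i (pderiv i u) x) * (∑ i, x i * pderiv i u x)
        - ∑ i, ∑ j, x i * pderiv j u x * pderiv j (pderiv i u) x) := by
  have : ∀ i j, x i * (u x ^ 2 * (pderiv j (pderiv j u) x * pderiv i u x
        - pderiv j (pderiv i u) x * pderiv j u x)) =
      u x ^ 2 * ((x i * pderiv i u x) * pderiv j (pderiv j u) x
        - x i * pderiv j u x * pderiv j (pderiv i u) x) := by
    intro i j; ring
  simp only [Finset.mul_sum, this]
  simp only [← Finset.mul_sum, Finset.sum_sub_distrib, ← Finset.sum_mul]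
  ring

lemma sum_x_gradientCube (x : Euc (n + 1)) :
    ∑ i, x i * (u x * (∑ j, pderiv j u x ^ 2) * pderiv i u x) =
      u x * (∑ j, pderiv j u x ^ 2) * ∑ i, x i * pderiv i u x := by
  rw [Finset.mul_sum Finset.univ fun i => x i * pderiv i u x]
  exact Finset.sum_congr rfl fun i _ => by ring

/-- The energy as an integral of first-order quantities, up to the `σ₁`-curvature. -/
theorem E2_eq (hn : 4 ≤ n) (hu : ContDiff ℝ ∞ u)
    (hpos : ∀ x ∈ closedBall (0 : Euc (n + 1)) 1, 0 < u x) :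
    E2 n u = (∫ x in closedBall (0 : Euc (n + 1)) 1,
        (∑ i, pderiv i u x ^ 2) * (sigma1 n u x + (∑ i, pderiv i u x ^ 2) / 2)) +
      ∫ t : sphere (0 : Euc (n + 1)) 1, (((n : ℝ) - 3) / 4 * u t *
          ((∑ i, pderiv i u t ^ 2) - (∑ i, (t : Euc (n + 1)) i * pderiv i u t) ^ 2) *
          (meanH n u t + ((n : ℝ) - 3) / 4 * u t)
        + ((n : ℝ) - 3) / 12 * u t * ((∑ i, (t : Euc (n + 1)) i * pderiv i u t) ^ 3
          + n * (((n : ℝ) - 3) / 4) ^ 2 * u t ^ 3)) ∂surface n := by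
  have hV : ∀ i, ContDiff ℝ ∞ (pderiv i u) := fun i => contDiff_pderiv i hu
  have hD : ∀ i j, ContDiff ℝ ∞ (pderiv j (pderiv i u)) := fun i j => contDiff_pderiv j (hV i)
  have cu := hu.continuous
  have cV : ∀ i, Continuous (pderiv i u) := fun i => (hV i).continuous
  have cD : ∀ i j, Continuous (pderiv j (pderiv i u)) := fun i j => (hD i j).continuous
  have cx : ∀ i : Fin (n + 1), Continuous fun x : Euc (n + 1) => x i := fun i =>
    (differentiable_coord i).continuous
  set k : ℝ := ((n : ℝ) - 3) / 4 with hk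
  have hnk : (n : ℝ) = 4 * k + 3 := by rw [hk]; ring
  set N : Fin (n + 1) → Euc (n + 1) → ℝ := fun i x => u x ^ 2 *
    ∑ j, (pderiv j (pderiv j u) x * pderiv i u x - pderiv j (pderiv i u) x * pderiv j u x) with hN
  set G : Fin (n + 1) → Euc (n + 1) → ℝ := fun i x =>
    u x * (∑ j, pderiv j u x ^ 2) * pderiv i u x with hG
  have sN : ∀ i, ContDiff ℝ ∞ (N i) := fun i => (hu.pow 2).mul
    (ContDiff.sum fun j _ => ((hD j j).mul (hV i)).sub ((hD i j).mul (hV j)))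
  have sG : ∀ i, ContDiff ℝ ∞ (G i) := fun i =>
    (hu.mul (ContDiff.sum fun j _ => (hV j).pow 2)).mul (hV i)
  have cN : ∀ i, Continuous (pderiv i (N i)) := fun i => (contDiff_pderiv i (sN i)).continuous
  have cG : ∀ i, Continuous (pderiv i (G i)) := fun i => (contDiff_pderiv i (sG i)).continuous
  have cN' : ∀ i, Continuous (N i) := fun i => (sN i).continuous
  have cG' : ∀ i, Continuous (G i) := fun i => (sG i).continuous
  have hs1 : ∀ x, sigma1 n u x = -k * u x * (∑ i, pderiv i (pderiv i u) x)
      - ((n : ℝ) + 1) / 4 * ∑ i, pderiv i u x ^ 2 := by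
    intro x; rw [sigma1, laplacian_eq_sum hu, norm_gradient_sq]
  have hmh : ∀ x, meanH n u x = (∑ i, x i * pderiv i u x) + k * u x := by
    intro x; rw [meanH, fderiv_eq_sum]
  -- the interior term
  have hI : ∫ x in closedBall (0 : Euc (n + 1)) 1, u x * L4 n u x =
      (∫ x in closedBall (0 : Euc (n + 1)) 1,
        (∑ i, pderiv i u x ^ 2) * (sigma1 n u x + (∑ i, pderiv i u x ^ 2) / 2)) +
      ∫ t : sphere (0 : Euc (n + 1)) 1, (k / 2 * (∑ i, (t : Euc (n + 1)) i * N i t)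
        + ((n : ℝ) - 1) / 4 * (∑ i, (t : Euc (n + 1)) i * G i t)) ∂surface n := by
    -- The coefficient k/2 matches the term u²((Δu)² − |∇²u|²). The coefficient (n-1)/4 then matches
    -- ∇²u(∇u, ∇u), and the remaining terms are exactly |∇u|²(σ₁ + |∇u|²/2).
    have e1 : ∀ x ∈ closedBall (0 : Euc (n + 1)) 1, u x * L4 n u x =
        (∑ i, pderiv i u x ^ 2) * (sigma1 n u x + (∑ i, pderiv i u x ^ 2) / 2)
        + (k / 2 * (∑ i, pderiv i (N i) x) + ((n : ℝ) - 1) / 4 * ∑ i, pderiv i (G i) x) := by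
      intro x hx
      rw [mul_L4_eq hn hu (hpos x hx), hs1, divergence_newton hu x, divergence_gradientCube hu x,
        hnk]
      ring
    rw [setIntegral_congr_fun measurableSet_closedBall e1, integral_add, integral_add,
      integral_const_mul, integral_const_mul, integral_divergence_ball fun i => (sN i).of_le (by simp),
      integral_divergence_ball fun i => (sG i).of_le (by simp), integral_add, integral_const_mul,
      integral_const_mul]
    · exact integrable_sphere (F := fun t => k / 2 * (∑ i, t i * N i t)) (by fun_prop)
    · exact integrable_sphere (F := fun t => ((n : ℝ) - 1) / 4 * (∑ i, t i * G i t)) (by fun_prop)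
    · exact integrableOn_ball (by fun_prop) 1
    · exact integrableOn_ball (by fun_prop) 1
    · simp only [hs1]
      exact integrableOn_ball (by fun_prop) 1
    · exact integrableOn_ball (by fun_prop) 1
  -- the boundary term
  set psi : Euc (n + 1) → ℝ := fun x =>
    k / 2 * (u x ^ 2 * ∑ i, x i * pderiv i u x) + k ^ 2 * u x ^ 3 with hpsi
  have spsi : ContDiff ℝ ∞ psi := by
    have : ContDiff ℝ ∞ fun x : Euc (n + 1) => ∑ i, x i * pderiv i u x :=
      ContDiff.sum fun i _ => (contDiff_coord i).mul (hV i)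
    exact (contDiff_const.mul ((hu.pow 2).mul this)).add (contDiff_const.mul (hu.pow 3))
  have cpsi := spsi.continuous
  have cdpsi : ∀ j, Continuous (pderiv j psi) := fun j => (contDiff_pderiv j spsi).continuous
  have hibp := integral_sphere_tangential_ibp spsi hu
  have hB3 : ∀ t : sphere (0 : Euc (n + 1)) 1, u t * B3 n u t = u t * (
      meanH n u t * (-(k * u t) * (∑ i, pderiv i (pderiv i u) t
          - ∑ i, ∑ j, (t : Euc (n + 1)) i * (t : Euc (n + 1)) j * pderiv j (pderiv i u) t)
        - ((n : ℝ) - 1) / 4 * (∑ i, pderiv i u t ^ 2)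
        - ((n : ℝ) + 1) / 4 * (∑ i, (t : Euc (n + 1)) i * pderiv i u t) ^ 2)
      + (n : ℝ) / 3 * meanH n u t ^ 3) := by
    intro t
    rw [B3_eq hn hu (hpos _ (sphere_subset_closedBall t.2)) (norm_eq_of_mem_sphere t)]
  have iB3 : Integrable (fun t : sphere (0 : Euc (n + 1)) 1 => u t * B3 n u t) (surface n) := by
    simp only [hB3, hmh]
    exact integrable_sphere (F := fun t => u t * (
      (∑ i, t i * pderiv i u t + k * u t) * (-(k * u t) * (∑ i, pderiv i (pderiv i u) t
          - ∑ i, ∑ j, t i * t j * pderiv j (pderiv i u) t)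
        - ((n : ℝ) - 1) / 4 * (∑ i, pderiv i u t ^ 2)
        - ((n : ℝ) + 1) / 4 * (∑ i, t i * pderiv i u t) ^ 2)
      + (n : ℝ) / 3 * (∑ i, t i * pderiv i u t + k * u t) ^ 3)) (by fun_prop)
  rw [E2, hI, add_assoc]
  congr 1
  -- The vanishing tangential integral is added to the boundary terms; after that the second
  -- derivatives cancel pointwise.
  rw [← add_zero (∫ t, u t * B3 n u t ∂surface n), ← hibp, ← integral_add iB3, ← integral_add]
  · refine integral_congr_ae (Filter.Eventually.of_forall fun t => ?_)
    obtain ⟨x, hx⟩ := t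
    have hB := hB3 ⟨x, hx⟩
    simp only at hB
    simp only [hB, hmh]
    rw [sum_x_newton, sum_x_gradientCube]
    simp only [hpsi, pderiv_ibpTest hu]
    have e1 : ∀ j, (k / 2 * (2 * u x * (∑ i, x i * pderiv i u x) * pderiv j u x
        + u x ^ 2 * (pderiv j u x + ∑ i, x i * pderiv j (pderiv i u) x))
      + 3 * k ^ 2 * u x ^ 2 * pderiv j u x) * pderiv j u x =
      (k * u x * (∑ i, x i * pderiv i u x) + k / 2 * u x ^ 2 + 3 * k ^ 2 * u x ^ 2)
        * pderiv j u x ^ 2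
      + k / 2 * u x ^ 2 * ∑ i, x i * pderiv j u x * pderiv j (pderiv i u) x := by
      intro j
      have : ∑ i, x i * pderiv j u x * pderiv j (pderiv i u) x =
        pderiv j u x * ∑ i, x i * pderiv j (pderiv i u) x := by
        rw [Finset.mul_sum]; exact Finset.sum_congr rfl fun i _ => by ring
      rw [this]; ring
    have e2 : ∀ j, x j * (k / 2 * (2 * u x * (∑ i, x i * pderiv i u x) * pderiv j u x
        + u x ^ 2 * (pderiv j u x + ∑ i, x i * pderiv j (pderiv i u) x))
      + 3 * k ^ 2 * u x ^ 2 * pderiv j u x) =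
      (k * u x * (∑ i, x i * pderiv i u x) + k / 2 * u x ^ 2 + 3 * k ^ 2 * u x ^ 2)
        * (x j * pderiv j u x)
      + k / 2 * u x ^ 2 * ∑ i, x i * x j * pderiv j (pderiv i u) x := by
      intro j
      have : ∑ i, x i * x j * pderiv j (pderiv i u) x =
        x j * ∑ i, x i * pderiv j (pderiv i u) x := by
        rw [Finset.mul_sum]; exact Finset.sum_congr rfl fun i _ => by ring
      rw [this]; ring
    rw [Finset.sum_congr rfl fun j _ => e1 j, Finset.sum_congr rfl fun j _ => e2 j]
    simp only [Finset.sum_add_distrib, ← Finset.mul_sum]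
    rw [show ∑ j, ∑ i, x i * pderiv j u x * pderiv j (pderiv i u) x =
        ∑ i, ∑ j, x i * pderiv j u x * pderiv j (pderiv i u) x from Finset.sum_comm,
      show ∑ j, ∑ i, x i * x j * pderiv j (pderiv i u) x =
        ∑ i, ∑ j, x i * x j * pderiv j (pderiv i u) x from Finset.sum_comm, hnk]
    ring
  · exact integrable_sphere (F := fun t => k / 2 * (∑ i, t i * N i t)
        + ((n : ℝ) - 1) / 4 * (∑ i, t i * G i t)) (by fun_prop)
  · refine iB3.add (integrable_sphere (F := fun t => ((∑ j, pderiv j psi t * pderiv j u t)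
      - (∑ j, t j * pderiv j psi t) * (∑ i, t i * pderiv i u t)
      + psi t * (∑ j, pderiv j (pderiv j u) t
        - ∑ i, ∑ j, t i * t j * pderiv j (pderiv i u) t
        - n * ∑ i, t i * pderiv i u t))) (by fun_prop))
  · exact integrable_sphere (F := fun t => ((∑ j, pderiv j psi t * pderiv j u t)
      - (∑ j, t j * pderiv j psi t) * (∑ i, t i * pderiv i u t)
      + psi t * (∑ j, pderiv j (pderiv j u) t
        - ∑ i, ∑ j, t i * t j * pderiv j (pderiv i u) t
        - n * ∑ i, t i * pderiv i u t))) (by fun_prop)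

/-- Coercivity of the energy on the cone `C₁`. -/
theorem E2_ge (hn : 4 ≤ n) (hu : u ∈ C1 n) :
    1 / 2 * (∫ x in closedBall (0 : Euc (n + 1)) 1, ‖fderiv ℝ u x‖ ^ 4) +
      (((n : ℝ) - 3) / 4) ^ 3 * ((n : ℝ) + 1) / 4 *
        ∫ t : sphere (0 : Euc (n + 1)) 1, u t ^ 4 ∂surface n ≤ E2 n u := by
  obtain ⟨hs, hpos, hsig, hH⟩ := hu
  have h4 : (4 : ℝ) ≤ n := by exact_mod_cast hn
  have hV : ∀ i, ContDiff ℝ ∞ (pderiv i u) := fun i => contDiff_pderiv i hs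
  have hD : ∀ i j, ContDiff ℝ ∞ (pderiv j (pderiv i u)) := fun i j => contDiff_pderiv j (hV i)
  have cu := hs.continuous
  have cV : ∀ i, Continuous (pderiv i u) := fun i => (hV i).continuous
  have cD : ∀ i j, Continuous (pderiv j (pderiv i u)) := fun i j => (hD i j).continuous
  have cx : ∀ i : Fin (n + 1), Continuous fun x : Euc (n + 1) => x i := fun i =>
    (differentiable_coord i).continuous
  have cf : Continuous (fderiv ℝ u) := hs.continuous_fderiv (by simp)
  rw [E2_eq hn hs hpos, ← integral_const_mul, ← integral_const_mul]
  refine add_le_add ?_ ?_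
  · refine setIntegral_mono_on (integrableOn_ball (by fun_prop) 1) ?_ measurableSet_closedBall
      fun x hx => ?_
    · simp only [sigma1, laplacian_eq_sum hs, norm_gradient_sq]
      exact integrableOn_ball (by fun_prop) 1
    · have h0 := hsig x hx
      have h1 : 0 ≤ ∑ i, pderiv i u x ^ 2 := by positivity
      rw [show ‖fderiv ℝ u x‖ ^ 4 = (‖fderiv ℝ u x‖ ^ 2) ^ 2 by ring, norm_fderiv_sq]
      nlinarith [mul_nonneg h0 h1]
  · refine integral_mono (integrable_sphere (F := fun t => (((n : ℝ) - 3) / 4) ^ 3 *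
      ((n : ℝ) + 1) / 4 * u t ^ 4) (by fun_prop)) ?_ fun t => ?_
    · simp only [meanH, fderiv_eq_sum]
      exact integrable_sphere (F := fun t => ((n : ℝ) - 3) / 4 * u t *
          ((∑ i, pderiv i u t ^ 2) - (∑ i, t i * pderiv i u t) ^ 2) *
          ((∑ i, t i * pderiv i u t + ((n : ℝ) - 3) / 4 * u t) + ((n : ℝ) - 3) / 4 * u t)
        + ((n : ℝ) - 3) / 12 * u t * ((∑ i, t i * pderiv i u t) ^ 3
          + n * (((n : ℝ) - 3) / 4) ^ 2 * u t ^ 3)) (by fun_prop)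
    · obtain ⟨x, hx⟩ := t
      have hx1 : ∑ i, x i ^ 2 = 1 := by
        rw [sum_sq_coord, mem_sphere_zero_iff_norm.1 hx]; norm_num
      have hup := hpos x (sphere_subset_closedBall hx)
      have hm := hH x hx
      -- Cauchy–Schwarz with |x| = 1: the difference is |∇'u|².
      have hcs : (∑ i, x i * pderiv i u x) ^ 2 ≤ ∑ i, pderiv i u x ^ 2 := by
        have := Finset.sum_mul_sq_le_sq_mul_sq Finset.univ (fun i => x i) fun i => pderiv i u x
        rwa [hx1, one_mul] at this
      have hm' : 0 < ∑ i, x i * pderiv i u x + ((n : ℝ) - 3) / 4 * u x := by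
        rwa [meanH, fderiv_eq_sum] at hm
      simp only
      set p := ∑ i, x i * pderiv i u x
      set k : ℝ := ((n : ℝ) - 3) / 4 with hk
      have hk0 : 0 < k := by rw [hk]; linarith
      have hku : 0 < k * u x := mul_pos hk0 hup
      -- This is where H(u) > 0 enters: p > −ku, and cubing is monotone.
      have hp3 : -(k * u x) ^ 3 ≤ p ^ 3 := by
        have h1 : (-(k * u x)) ^ 3 ≤ p ^ 3 :=
          (Odd.strictMono_pow (by decide : Odd 3)).monotone (by linarith)
        calc _ = (-(k * u x)) ^ 3 := by ring
          _ ≤ _ := h1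
      have hA : 0 ≤ k * u x * (∑ i, pderiv i u x ^ 2 - p ^ 2) * (meanH n u x + k * u x) :=
        mul_nonneg (mul_nonneg hku.le (by linarith)) (by linarith)
      have hnk : (n : ℝ) = 4 * k + 3 := by rw [hk]; ring
      have hB : 0 ≤ k * u x * (p ^ 3 + (k * u x) ^ 3) := mul_nonneg hku.le (by linarith)
      have h12 : ((n : ℝ) - 3) / 12 = k / 3 := by rw [hk]; ring
      rw [h12]
      -- With n = 4k + 3, (n − k)/3 = k + 1 = (n+1)/4. This is the boundary constant that survives
      -- the worst case p = −ku.
      have : k ^ 3 * ((n : ℝ) + 1) / 4 * u x ^ 4 =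
        k / 3 * u x * (n * k ^ 2 * u x ^ 3 - (k * u x) ^ 3) := by rw [hnk]; ring
      rw [this]
      nlinarith

end EnergyIdentity

/-! ### The L¹ Sobolev inequality on the ball, with a boundary term. -/

section BallSobolev

variable {n : ℕ}

/-- A nondecreasing `C¹` step from `0` on `t ≤ 0` to `1` on `t ≥ 1`. -/
lemma exists_step : ∃ φ ψ : ℝ → ℝ, Continuous ψ ∧ (∀ t, HasDerivAt φ (ψ t) t) ∧ (∀ t, 0 ≤ ψ t) ∧
    (∀ t ≤ 0, φ t = 0) ∧ (∀ t ≤ 0, ψ t = 0) ∧ (∀ t, 1 ≤ t → φ t = 1) ∧ (∀ t, 1 ≤ t → ψ t = 0) := by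
  -- The derivative is the tent on [0, 1] with peak 2 at t = 1/2, hence of area 1.
  refine ⟨fun t => 2 * max t 0 ^ 2 - 4 * max (t - 1 / 2) 0 ^ 2 + 2 * max (t - 1) 0 ^ 2,
    fun t => 4 * max t 0 - 8 * max (t - 1 / 2) 0 + 4 * max (t - 1) 0, by fun_prop,
    fun t => ?_, fun t => ?_, fun t ht => ?_, fun t ht => ?_, fun t ht => ?_, fun t ht => ?_⟩
  · have h1 := (hasDerivAt_max_sq t).const_mul 2
    have h2 := ((hasDerivAt_max_sq (t - 1 / 2)).comp_sub_const t (1 / 2)).const_mul 4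
    have h3 := ((hasDerivAt_max_sq (t - 1)).comp_sub_const t 1).const_mul 2
    convert! (h1.fun_sub h2).fun_add h3 using 1
    ring
  · simp only
    rcases le_total t 0 with h0 | h0
    · rw [max_eq_right h0, max_eq_right (by linarith), max_eq_right (by linarith)]; norm_num
    rcases le_total t (1 / 2) with h1 | h1
    · rw [max_eq_left h0, max_eq_right (by linarith), max_eq_right (by linarith)]; linarith
    rcases le_total t 1 with h2 | h2
    · rw [max_eq_left h0, max_eq_left (by linarith), max_eq_right (by linarith)]; linarith
    · rw [max_eq_left h0, max_eq_left (by linarith), max_eq_left (by linarith)]; linarith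
  · simp only
    rw [max_eq_right ht, max_eq_right (by linarith), max_eq_right (by linarith)]; norm_num
  · simp only
    rw [max_eq_right ht, max_eq_right (by linarith), max_eq_right (by linarith)]; norm_num
  · simp only
    rw [max_eq_left (by linarith), max_eq_left (by linarith), max_eq_left (by linarith)]; ring
  · simp only
    rw [max_eq_left (by linarith), max_eq_left (by linarith), max_eq_left (by linarith)]; ring

/-- The Gagliardo–Nirenberg–Sobolev inequality with exponent `1`, in terms of real integrals. -/
lemma exists_gagliardo_nirenberg (hn : 1 ≤ n) : ∃ C : ℝ, 0 < C ∧ ∀ g : Euc (n + 1) → ℝ,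
    ContDiff ℝ 1 g → HasCompactSupport g →
    (∫ x, |g x| ^ (((n : ℝ) + 1) / n)) ^ ((n : ℝ) / (n + 1)) ≤ C * ∫ x, ‖fderiv ℝ g x‖ := by
  have hn0 : (0 : ℝ) < n := by exact_mod_cast hn
  set p : NNReal := ((n : NNReal) + 1) / n with hp
  have hpr : (p : ℝ) = ((n : ℝ) + 1) / n := by simp [hp]
  have hpp : 0 < p := by rw [← NNReal.coe_pos, hpr]; positivity
  refine ⟨eLpNormLESNormFDerivOneConst (volume : Measure (Euc (n + 1))) p + 1,
    by positivity, fun g hg hcg => ?_⟩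
  have hconj : NNReal.HolderConjugate (Module.finrank ℝ (Euc (n + 1))) p := by
    rw [NNReal.holderConjugate_iff]
    have : (n : NNReal) ≠ 0 := by exact_mod_cast hn0.ne'
    constructor
    · simp; omega
    · simp only [finrank_euclideanSpace, Fintype.card_fin, hp]
      push_cast
      field_simp
      ring
  have key := eLpNorm_le_eLpNorm_fderiv_one (volume : Measure (Euc (n + 1))) hg hcg hconj
  set N : NNReal := eLpNormLESNormFDerivOneConst (volume : Measure (Euc (n + 1))) p
  have cg := hg.continuous
  have cdg := hg.continuous_fderiv one_ne_zero
  have m1 : MemLp g p := cg.memLp_of_hasCompactSupport hcg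
  have i1 : Integrable (fderiv ℝ g) := cdg.integrable_of_hasCompactSupport (hcg.fderiv ℝ)
  rw [m1.eLpNorm_eq_integral_rpow_norm (by exact_mod_cast hpp.ne') ENNReal.coe_ne_top,
    eLpNorm_one_eq_lintegral_enorm, ← ofReal_integral_norm_eq_lintegral_enorm i1] at key
  rw [show (N : ENNReal) = ENNReal.ofReal (N : ℝ) by simp, ← ENNReal.ofReal_mul (by positivity),
    ENNReal.ofReal_le_ofReal_iff (by positivity)] at key
  simp only [ENNReal.coe_toReal, hpr, Real.norm_eq_abs, inv_div] at key
  refine key.trans ?_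
  have : 0 ≤ ∫ x, ‖fderiv ℝ g x‖ := by positivity
  nlinarith

/-- The inequality for compactly supported functions is applied to ηf, where η is a radial cutoff
equal to 1 on the R-ball and 0 outside the unit ball. The density |∇η| has radial integral 1, so
∫|f||∇η| is a weighted average of the sphere integrals over R ≤ r ≤ 1. The constant therefore does
not deteriorate as R tends to 1. -/
lemma integral_ball_rpow_le_of_bound {C : ℝ} (hC : 0 < C)
    (hgns : ∀ g : Euc (n + 1) → ℝ, ContDiff ℝ 1 g → HasCompactSupport g →
      (∫ x, |g x| ^ (((n : ℝ) + 1) / n)) ^ ((n : ℝ) / (n + 1)) ≤ C * ∫ x, ‖fderiv ℝ g x‖)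
    (hn : 1 ≤ n)
    {f : Euc (n + 1) → ℝ} (hf : ContDiff ℝ 1 f) {R M : ℝ} (hR0 : 0 < R) (hR1 : R < 1)
    (hM : ∀ r, R ≤ r → r ≤ 1 →
      r ^ n * ∫ t : sphere (0 : Euc (n + 1)) 1, |f (r • (t : Euc (n + 1)))| ∂surface n ≤ M) :
    (∫ x in closedBall (0 : Euc (n + 1)) R, |f x| ^ (((n : ℝ) + 1) / n)) ^ ((n : ℝ) / (n + 1)) ≤
      C * ((∫ x in closedBall (0 : Euc (n + 1)) 1, ‖fderiv ℝ f x‖) + M) := by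
  obtain ⟨φ, ψ, cψ, hd, hψ, hφ0, hψ0, hφ1, hψ1⟩ := exists_step
  have hn0 : (0 : ℝ) < n := by exact_mod_cast hn
  set e : ℝ := 1 - R ^ 2 with he
  have he0 : 0 < e := by rw [he]; nlinarith
  have he1 : e ≤ 1 := by rw [he]; nlinarith
  -- The square of the radius keeps the cutoff C¹ at the origin.
  set w : ℝ → ℝ := fun r => (1 - r ^ 2) / e with hw
  set eta : Euc (n + 1) → ℝ := fun x => φ (w ‖x‖) with heta
  have cφ : Continuous φ := continuous_iff_continuousAt.2 fun t => (hd t).continuousAt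
  have hφmono : Monotone φ := monotone_of_hasDerivAt_nonneg hd fun t => hψ t
  have hφnn : ∀ t, 0 ≤ φ t := by
    intro t
    rcases le_total t 0 with h | h
    · exact (hφ0 t h).ge
    · rw [← hφ0 0 le_rfl]; exact hφmono h
  have hφle : ∀ t, φ t ≤ 1 := by
    intro t
    rcases le_total t 1 with h | h
    · rw [← hφ1 1 le_rfl]; exact hφmono h
    · exact (hφ1 t h).le
  have hφC : ContDiff ℝ 1 φ := by
    rw [contDiff_one_iff_deriv]
    exact ⟨fun t => (hd t).differentiableAt, by
      rw [show deriv φ = ψ from funext fun t => (hd t).deriv]; exact cψ⟩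
  have hwx : ContDiff ℝ 1 fun x : Euc (n + 1) => w ‖x‖ :=
    (contDiff_const.sub (contDiff_norm_sq ℝ)).div_const e
  have hetaC : ContDiff ℝ 1 eta := hφC.comp hwx
  have hwd : ∀ x : Euc (n + 1), HasFDerivAt (fun x : Euc (n + 1) => w ‖x‖)
      (-(2 / e) • (innerSL ℝ x : Euc (n + 1) →L[ℝ] ℝ)) x := by
    intro x
    have h1 := ((hasStrictFDerivAt_norm_sq x).hasFDerivAt.const_sub 1).mul_const e⁻¹
    convert! h1 using 1
    ext v
    simp
    ring
  have hetad : ∀ x, fderiv ℝ eta x = ψ (w ‖x‖) • (-(2 / e) • (innerSL ℝ x : Euc (n + 1) →L[ℝ] ℝ)) :=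
    fun x => ((hd (w ‖x‖)).comp_hasFDerivAt x (hwd x)).fderiv
  set K : ℝ → ℝ := fun r => ψ (w r) * (2 * r / e) with hK
  have cw : Continuous w := by fun_prop
  have cK : Continuous K := by fun_prop
  have hwneg : ∀ r, 1 < r → w r ≤ 0 := fun r hr =>
    div_nonpos_of_nonpos_of_nonneg (by nlinarith) he0.le
  have hwbig : ∀ r, 0 ≤ r → r ≤ R → 1 ≤ w r := fun r h0 hr => by
    rw [hw, one_le_div he0, he]; nlinarith
  have hetanorm : ∀ x, ‖fderiv ℝ eta x‖ = K ‖x‖ := by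
    intro x
    rw [hetad, norm_smul, norm_smul, innerSL_apply_norm, Real.norm_of_nonneg (hψ _), norm_neg,
      Real.norm_of_nonneg (by positivity)]
    simp only [hK]; ring
  have hetaout : ∀ x : Euc (n + 1), 1 < ‖x‖ → eta x = 0 := fun x hx => hφ0 _ (hwneg _ hx)
  have hKout : ∀ r, 1 < r → K r = 0 := fun r hr => by simp [hK, hψ0 _ (hwneg _ hr)]
  set g : Euc (n + 1) → ℝ := fun x => eta x * f x with hg
  have hgC : ContDiff ℝ 1 g := hetaC.mul hf
  have hcs : ∀ F : Euc (n + 1) → ℝ, (∀ x, 1 < ‖x‖ → F x = 0) → HasCompactSupport F := by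
    intro F hF
    refine HasCompactSupport.of_support_subset_isCompact (isCompact_closedBall 0 1) ?_
    intro x hx
    by_contra hc
    simp only [mem_closedBall, dist_zero_right, not_le] at hc
    exact hx (hF x hc)
  have hgcs : HasCompactSupport g := hcs g fun x hx => by simp [hg, hetaout x hx]
  have cf := hf.continuous
  have cdf := hf.continuous_fderiv one_ne_zero
  have cg := hgC.continuous
  have h1 := hgns g hgC hgcs
  have iK : Integrable fun x : Euc (n + 1) => K ‖x‖ * |f x| :=
    Continuous.integrable_of_hasCompactSupport (by fun_prop)
      (hcs _ fun x hx => by simp [hKout _ hx])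
  have iI : Integrable ((closedBall (0 : Euc (n + 1)) 1).indicator fun x => ‖fderiv ℝ f x‖) :=
    (integrableOn_ball (by fun_prop) 1).integrable_indicator measurableSet_closedBall
  have hpt : ∀ x, ‖fderiv ℝ g x‖ ≤ (closedBall (0 : Euc (n + 1)) 1).indicator
      (fun x => ‖fderiv ℝ f x‖) x + K ‖x‖ * |f x| := by
    intro x
    have hfd : fderiv ℝ g x = eta x • fderiv ℝ f x + f x • fderiv ℝ eta x :=
      fderiv_fun_mul (hetaC.differentiable one_ne_zero x) (hf.differentiable one_ne_zero x)
    rw [hfd]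
    refine (norm_add_le _ _).trans (add_le_add ?_ ?_)
    · rw [norm_smul]
      by_cases hx : ‖x‖ ≤ 1
      · rw [Set.indicator_of_mem (by simpa using hx)]
        have : ‖eta x‖ ≤ 1 := by rw [Real.norm_of_nonneg (hφnn _)]; exact hφle _
        exact mul_le_of_le_one_left (norm_nonneg _) this
      · rw [hetaout x (not_le.1 hx), norm_zero, zero_mul]
        exact Set.indicator_nonneg (fun _ _ => norm_nonneg _) _
    · rw [norm_smul, hetanorm, Real.norm_eq_abs, mul_comm]
  have hKM : ∫ x : Euc (n + 1), K ‖x‖ * |f x| ≤ M := by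
    rw [integral_radial_mul zero_le_one hKout iK]
    have hcont : Continuous fun r : ℝ =>
        ∫ t : sphere (0 : Euc (n + 1)) 1, |f (r • (t : Euc (n + 1)))| ∂surface n :=
      continuous_sphereIntegral (F := fun r t => |f (r • t)|) (by fun_prop)
    have h2 : ∫ r in (0 : ℝ)..1, K r * (r ^ n *
        ∫ t : sphere (0 : Euc (n + 1)) 1, |f (r • (t : Euc (n + 1)))| ∂surface n) ≤
        ∫ r in (0 : ℝ)..1, K r * M := by
      refine intervalIntegral.integral_mono_on zero_le_one
        (Continuous.intervalIntegrable (by fun_prop) _ _)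
        (Continuous.intervalIntegrable (by fun_prop) _ _) fun r hr => ?_
      rcases le_total R r with h | h
      · have : 0 ≤ K r := mul_nonneg (hψ _) (by have := hr.1; positivity)
        exact mul_le_mul_of_nonneg_left (hM r h hr.2) this
      · have : K r = 0 := by simp [hK, hψ1 _ (hwbig r hr.1 h)]
        simp [this]
    refine h2.trans ?_
    -- The function −K is the radial derivative of the cutoff, which drops from 1 to 0, so K has
    -- total mass 1.
    have h3 : ∫ r in (0 : ℝ)..1, -K r = φ (w 1) - φ (w 0) := by
      refine intervalIntegral.integral_eq_sub_of_hasDerivAt (f := fun r => φ (w r)) (fun r _ => ?_)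
        (Continuous.intervalIntegrable (by fun_prop) _ _)
      have hwr : HasDerivAt w (-(2 * r) / e) r := by
        have := ((hasDerivAt_pow 2 r).const_sub 1).div_const e
        convert! this using 1
        push_cast; ring
      have := (hd (w r)).comp r hwr
      convert! this using 1
      simp only [hK]; ring
    rw [intervalIntegral.integral_neg, hφ0 (w 1) (by simp [hw]),
      hφ1 (w 0) (hwbig 0 le_rfl hR0.le)] at h3
    rw [intervalIntegral.integral_mul_const, show ∫ r in (0 : ℝ)..1, K r = 1 by linarith, one_mul]
  have hp0 : (0 : ℝ) < ((n : ℝ) + 1) / n := by positivity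
  have hp1 : (0 : ℝ) < (n : ℝ) / (n + 1) := by positivity
  have hG : ∫ x in closedBall (0 : Euc (n + 1)) R, |f x| ^ (((n : ℝ) + 1) / n) ≤
      ∫ x, |g x| ^ (((n : ℝ) + 1) / n) := by
    have e1 : ∀ x ∈ closedBall (0 : Euc (n + 1)) R, |f x| ^ (((n : ℝ) + 1) / n) =
        |g x| ^ (((n : ℝ) + 1) / n) := by
      intro x hx
      have hx' : ‖x‖ ≤ R := by simpa using hx
      have : eta x = 1 := hφ1 _ (hwbig _ (norm_nonneg x) hx')
      simp [hg, this]
    rw [setIntegral_congr_fun measurableSet_closedBall e1]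
    refine setIntegral_le_integral ?_ (Filter.Eventually.of_forall fun x => by positivity)
    refine Continuous.integrable_of_hasCompactSupport ?_ (hcs _ fun x hx => ?_)
    · exact cg.abs.rpow_const fun x => Or.inr hp0.le
    · simp [hg, hetaout x hx, Real.zero_rpow hp0.ne']
  refine (Real.rpow_le_rpow (by positivity) hG hp1.le).trans (h1.trans ?_)
  refine mul_le_mul_of_nonneg_left ?_ hC.le
  have hdg : Integrable fun x => ‖fderiv ℝ g x‖ :=
    ((hgC.continuous_fderiv one_ne_zero).integrable_of_hasCompactSupport (hgcs.fderiv ℝ)).norm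
  calc ∫ x, ‖fderiv ℝ g x‖ ≤ ∫ x, ((closedBall (0 : Euc (n + 1)) 1).indicator
      (fun x => ‖fderiv ℝ f x‖) x + K ‖x‖ * |f x|) := integral_mono hdg (iI.add iK) hpt
    _ = (∫ x in closedBall (0 : Euc (n + 1)) 1, ‖fderiv ℝ f x‖) + ∫ x, K ‖x‖ * |f x| := by
      rw [integral_add iI iK, integral_indicator measurableSet_closedBall]
    _ ≤ _ := by gcongr

/-- The Sobolev inequality with exponent `1` on the unit ball, for functions that need not
vanish on the boundary. -/
theorem exists_ball_sobolev_one (hn : 1 ≤ n) : ∃ C : ℝ, 0 < C ∧ ∀ f : Euc (n + 1) → ℝ,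
    ContDiff ℝ 1 f →
    (∫ x in closedBall (0 : Euc (n + 1)) 1, |f x| ^ (((n : ℝ) + 1) / n)) ^ ((n : ℝ) / (n + 1)) ≤
      C * ((∫ x in closedBall (0 : Euc (n + 1)) 1, ‖fderiv ℝ f x‖) +
        ∫ t : sphere (0 : Euc (n + 1)) 1, |f t| ∂surface n) := by
  obtain ⟨C, hC, hgns⟩ := exists_gagliardo_nirenberg hn
  refine ⟨C, hC, fun f hf => ?_⟩
  have hn0 : (0 : ℝ) < n := by exact_mod_cast hn
  have cf := hf.continuous
  have hp0 : (0 : ℝ) < ((n : ℝ) + 1) / n := by positivity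
  have hp1 : (0 : ℝ) < (n : ℝ) / (n + 1) := by positivity
  have cfp : Continuous fun x => |f x| ^ (((n : ℝ) + 1) / n) :=
    cf.abs.rpow_const fun x => Or.inr hp0.le
  set h : ℝ → ℝ := fun r =>
    r ^ n * ∫ t : sphere (0 : Euc (n + 1)) 1, |f (r • (t : Euc (n + 1)))| ∂surface n with hh
  have hcont : Continuous h := (continuous_id.pow n).mul
      (continuous_sphereIntegral (F := fun r t => |f (r • t)|) (by fun_prop))
  have hh1 : h 1 = ∫ t : sphere (0 : Euc (n + 1)) 1, |f t| ∂surface n := by simp [hh]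
  set J : ℝ → ℝ := fun R => ∫ x in closedBall (0 : Euc (n + 1)) R, |f x| ^ (((n : ℝ) + 1) / n)
    with hJ
  have hJc : Filter.Tendsto J (nhdsWithin 1 (Set.Iio 1)) (nhds (J 1)) := by
    have hi : Continuous fun R : ℝ => ∫ r in (0 : ℝ)..R, r ^ n * ∫ t : sphere (0 : Euc (n + 1)) 1,
        |f (r • (t : Euc (n + 1)))| ^ (((n : ℝ) + 1) / n) ∂surface n :=
      intervalIntegral.continuous_primitive (fun a b => ((continuous_id.pow n).mul
        (continuous_sphereIntegral (F := fun r t => |f (r • t)| ^ (((n : ℝ) + 1) / n))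
          (cfp.comp (by fun_prop : Continuous fun p : ℝ × Euc (n + 1) => p.1 • p.2)))).intervalIntegrable
            a b) 0
    have h1 := (hi.tendsto 1).mono_left (nhdsWithin_le_nhds (s := Set.Iio 1))
    rw [← integral_ball_eq_polar cfp zero_le_one] at h1
    refine h1.congr' ?_
    filter_upwards [mem_nhdsWithin_of_mem_nhds (lt_mem_nhds (zero_lt_one (α := ℝ)))] with R hR
    exact (integral_ball_eq_polar cfp (le_of_lt hR)).symm
  -- For R close to 1 the sphere integrals on [R, 1] exceed the boundary one by at most δ/C. The
  -- constant C does not depend on R, so R may tend to 1.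
  refine le_of_forall_pos_le_add fun δ hδ => ?_
  have hev : ∀ᶠ R in nhdsWithin 1 (Set.Iio 1), J R ^ ((n : ℝ) / (n + 1)) ≤
      C * ((∫ x in closedBall (0 : Euc (n + 1)) 1, ‖fderiv ℝ f x‖) + (h 1 + δ / C)) := by
    have h1 : ∀ᶠ r in nhds (1 : ℝ), h r < h 1 + δ / C :=
      hcont.continuousAt.eventually (gt_mem_nhds (by have := div_pos hδ hC; linarith))
    obtain ⟨ρ, hρ, hball⟩ := Metric.eventually_nhds_iff.1 h1
    filter_upwards [self_mem_nhdsWithin,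
      mem_nhdsWithin_of_mem_nhds (lt_mem_nhds (show max 0 (1 - ρ) < (1 : ℝ) by
        rw [max_lt_iff]; constructor <;> linarith))] with R hR1 hR2
    rw [max_lt_iff] at hR2
    refine integral_ball_rpow_le_of_bound hC hgns hn hf hR2.1 hR1 fun r hr1 hr2 => ?_
    refine (hball ?_).le
    rw [Real.dist_eq, abs_lt]
    constructor <;> linarith
  have := le_of_tendsto (hJc.rpow_const (Or.inr hp1.le)) hev
  rw [hh1] at this
  refine this.trans (le_of_eq ?_)
  field_simp
  ring

end BallSobolev

/-! ### The trace inequality W^{1,4}(B) → L^{4n/(n-3)}(∂B). -/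

section TraceSobolev

variable {n : ℕ}

/-- Divergence theorem for the field f(x)x, whose normal component on the unit sphere is f. -/
lemma integral_sphere_eq_ball {f : Euc (n + 1) → ℝ} (hf : ContDiff ℝ 1 f) :
    ∫ t : sphere (0 : Euc (n + 1)) 1, f t ∂surface n =
      ((n : ℝ) + 1) * (∫ x in closedBall (0 : Euc (n + 1)) 1, f x) +
        ∫ x in closedBall (0 : Euc (n + 1)) 1, fderiv ℝ f x x := by
  have cf := hf.continuous
  have cdf := hf.continuous_fderiv one_ne_zero
  have h := integral_divergence_ball (f := fun i x => x i * f x)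
    fun i => (contDiff_coord i).mul hf
  have e1 : ∀ x, ∑ i, pderiv i (fun x : Euc (n + 1) => x i * f x) x =
      ((n : ℝ) + 1) * f x + fderiv ℝ f x x := by
    intro x
    have : ∀ i, pderiv i (fun x : Euc (n + 1) => x i * f x) x = f x + x i * pderiv i f x := by
      intro i
      rw [pderiv_mul i (differentiable_coord i x) (hf.differentiable one_ne_zero x), pderiv_coord]
      simp
    simp only [this, Finset.sum_add_distrib, fderiv_eq_sum]
    simp
  have e2 : ∀ t : sphere (0 : Euc (n + 1)) 1,
      ∑ i, (t : Euc (n + 1)) i * ((t : Euc (n + 1)) i * f t) = f t := by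
    intro t
    simp only [← mul_assoc, ← Finset.sum_mul, ← pow_two, sum_sq_coord, norm_eq_of_mem_sphere]
    ring
  simp only [e1, e2] at h
  rw [← h, integral_add (integrableOn_ball (by fun_prop) 1) (integrableOn_ball (by fun_prop) 1),
    integral_const_mul]

lemma abs_integral_fderiv_self_le {f : Euc (n + 1) → ℝ} (hf : ContDiff ℝ 1 f) :
    |∫ x in closedBall (0 : Euc (n + 1)) 1, fderiv ℝ f x x| ≤
      ∫ x in closedBall (0 : Euc (n + 1)) 1, ‖fderiv ℝ f x‖ := by
  have cdf := hf.continuous_fderiv one_ne_zero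
  refine abs_integral_le_integral_abs.trans (setIntegral_mono_on
    (integrableOn_ball (by fun_prop) 1) (integrableOn_ball (by fun_prop) 1)
    measurableSet_closedBall fun x hx => ?_)
  have hx' : ‖x‖ ≤ 1 := by simpa using hx
  exact ((fderiv ℝ f x).le_opNorm x).trans (mul_le_of_le_one_right (norm_nonneg _) hx')

/-- The previous identity for u⁴, with Young's inequality 4a³b ≤ 3a⁴ + b⁴, absorbs 3∫u⁴ into
(n+1)∫u⁴. The remaining factor n − 2 is at least 1. -/
lemma integral_pow_four_le {u : Euc (n + 1) → ℝ} (hn : 3 ≤ n) (hu : ContDiff ℝ 1 u) :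
    ∫ x in closedBall (0 : Euc (n + 1)) 1, u x ^ 4 ≤
      (∫ x in closedBall (0 : Euc (n + 1)) 1, ‖fderiv ℝ u x‖ ^ 4) +
        ∫ t : sphere (0 : Euc (n + 1)) 1, u t ^ 4 ∂surface n := by
  have h3 : (3 : ℝ) ≤ n := by exact_mod_cast hn
  have cu := hu.continuous
  have cdu := hu.continuous_fderiv one_ne_zero
  have hf : ContDiff ℝ 1 fun x => u x ^ 4 := hu.pow 4
  have h1 := integral_sphere_eq_ball hf
  have h2 := abs_le.1 (abs_integral_fderiv_self_le hf)
  have hd : ∀ x, ‖fderiv ℝ (fun x => u x ^ 4) x‖ ≤ 3 * u x ^ 4 + ‖fderiv ℝ u x‖ ^ 4 := by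
    intro x
    have : fderiv ℝ (fun x => u x ^ 4) x = (4 * u x ^ 3) • fderiv ℝ u x := by
      rw [fderiv_fun_pow 4 (hu.differentiable one_ne_zero x)]
      simp
    rw [this, norm_smul, Real.norm_eq_abs, abs_mul, abs_pow, ← Even.pow_abs (by decide : Even 4) (u x)]
    rw [abs_of_pos (by norm_num : (0 : ℝ) < 4)]
    have ha := abs_nonneg (u x)
    have hb := norm_nonneg (fderiv ℝ u x)
    generalize |u x| = a at *
    generalize ‖fderiv ℝ u x‖ = b at *
    -- 3a⁴ − 4a³b + b⁴ = (a − b)²(3a² + 2ab + b²).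
    nlinarith [mul_nonneg (sq_nonneg (a - b)) (by positivity : 0 ≤ 3 * a ^ 2 + 2 * a * b + b ^ 2)]
  have h4 : ∫ x in closedBall (0 : Euc (n + 1)) 1, ‖fderiv ℝ (fun x => u x ^ 4) x‖ ≤
      3 * (∫ x in closedBall (0 : Euc (n + 1)) 1, u x ^ 4) +
      ∫ x in closedBall (0 : Euc (n + 1)) 1, ‖fderiv ℝ u x‖ ^ 4 := by
    rw [← integral_const_mul, ← integral_add (integrableOn_ball (by fun_prop) 1)
      (integrableOn_ball (by fun_prop) 1)]
    exact setIntegral_mono_on (integrableOn_ball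
      (hf.continuous_fderiv one_ne_zero).norm 1) (integrableOn_ball (by fun_prop) 1)
      measurableSet_closedBall fun x _ => hd x
  have h5 : 0 ≤ ∫ x in closedBall (0 : Euc (n + 1)) 1, u x ^ 4 :=
    integral_nonneg fun x => by positivity
  nlinarith [h2.1]

/-- Chain rule followed by Hölder with exponents 4/3 and 4; `hqr` names the resulting power of |u|.
-/
lemma integral_fderiv_rpow_le {u : Euc (n + 1) → ℝ} (hu : ContDiff ℝ 1 u) {q r : ℝ} (hq : 1 < q)
    (hqr : (q - 1) * (4 / 3) = r) :
    ∫ x in closedBall (0 : Euc (n + 1)) 1, ‖fderiv ℝ (fun x => |u x| ^ q) x‖ ≤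
      q * ((∫ x in closedBall (0 : Euc (n + 1)) 1, |u x| ^ r) ^ (3 / 4 : ℝ) *
        (∫ x in closedBall (0 : Euc (n + 1)) 1, ‖fderiv ℝ u x‖ ^ 4) ^ (1 / 4 : ℝ)) := by
  have cu := hu.continuous
  have cdu := hu.continuous_fderiv one_ne_zero
  have hf : ContDiff ℝ 1 fun x => |u x| ^ q := hu.norm_rpow hq
  have cq : Continuous fun x => |u x| ^ (q - 1) :=
    cu.abs.rpow_const fun x => Or.inr (by linarith)
  have h1 : ∫ x in closedBall (0 : Euc (n + 1)) 1, ‖fderiv ℝ (fun x => |u x| ^ q) x‖ ≤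
      q * ∫ x in closedBall (0 : Euc (n + 1)) 1, |u x| ^ (q - 1) * ‖fderiv ℝ u x‖ := by
    rw [← integral_const_mul]
    refine setIntegral_mono_on (integrableOn_ball (hf.continuous_fderiv one_ne_zero).norm 1)
      (integrableOn_ball (by fun_prop) 1) measurableSet_closedBall fun x _ => ?_
    have := norm_fderiv_norm_rpow_le (hu.differentiable one_ne_zero) (x := x) hq
    rw [mul_assoc] at this
    exact this
  refine h1.trans (mul_le_mul_of_nonneg_left ?_ (by linarith))
  have hm : ∀ (F : Euc (n + 1) → ℝ), Continuous F → ∀ p : ENNReal,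
      MemLp F p (volume.restrict (closedBall (0 : Euc (n + 1)) 1)) := by
    intro F hF p
    obtain ⟨M, hM⟩ := (isCompact_closedBall (0 : Euc (n + 1)) 1).exists_bound_of_continuousOn
      hF.continuousOn
    have : IsFiniteMeasure (volume.restrict (closedBall (0 : Euc (n + 1)) 1)) :=
      isFiniteMeasure_restrict.2 measure_closedBall_lt_top.ne
    exact MemLp.of_bound hF.aestronglyMeasurable M
      ((ae_restrict_iff' measurableSet_closedBall).2 (Filter.Eventually.of_forall hM))
  have h2 := integral_mul_le_Lp_mul_Lq_of_nonneg (p := 4 / 3) (q := 4)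
    (μ := volume.restrict (closedBall (0 : Euc (n + 1)) 1))
    (Real.holderConjugate_iff.2 ⟨by norm_num, by norm_num⟩)
    (f := fun x => |u x| ^ (q - 1)) (g := fun x => ‖fderiv ℝ u x‖)
    (Filter.Eventually.of_forall fun x => by positivity)
    (Filter.Eventually.of_forall fun x => norm_nonneg _) (hm _ cq _) (hm _ cdu.norm _)
  refine h2.trans (le_of_eq ?_)
  have e1 : ∀ x, (|u x| ^ (q - 1)) ^ (4 / 3 : ℝ) = |u x| ^ r := by
    intro x; rw [← Real.rpow_mul (abs_nonneg _), hqr]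
  simp only [e1]
  congr 2
  · norm_num
  · congr 1; funext x; norm_cast

/-- The Sobolev trace inequality `W^{1,4}(B) → L^{4n/(n-3)}(∂B)`, for the normalization
`∮ |u|^{4n/(n-3)} = 1`. -/
theorem exists_sobolev_trace (hn : 4 ≤ n) : ∃ c : ℝ, 0 < c ∧ ∀ u : Euc (n + 1) → ℝ,
    ContDiff ℝ 1 u →
    ∫ t : sphere (0 : Euc (n + 1)) 1, |u t| ^ (4 * (n : ℝ) / ((n : ℝ) - 3)) ∂surface n = 1 →
    c ≤ (∫ x in closedBall (0 : Euc (n + 1)) 1, ‖fderiv ℝ u x‖ ^ 4) +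
        ∫ t : sphere (0 : Euc (n + 1)) 1, u t ^ 4 ∂surface n := by
  have h4 : (4 : ℝ) ≤ n := by exact_mod_cast hn
  have h3 : (0 : ℝ) < (n : ℝ) - 3 := by linarith
  obtain ⟨C, hC, hsob⟩ := exists_ball_sobolev_one (n := n) (by lia)
  set q : ℝ := 4 * (n : ℝ) / ((n : ℝ) - 3) with hq
  -- The critical interior exponent satisfies both r = q(n+1)/n, from Sobolev for |u|^q, and r =
  -- (4/3)(q − 1), from Hölder. Thus a single quantity X = ∫|u|^r closes the estimate.
  set r : ℝ := 4 * ((n : ℝ) + 1) / ((n : ℝ) - 3) with hr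
  have hq4 : 4 < q := by rw [hq, lt_div_iff₀ h3]; linarith
  have hqr : q < r := by rw [hq, hr]; gcongr; linarith
  have hqr' : (q - 1) * (4 / 3) = r := by rw [hq, hr]; field_simp; ring
  have hqp : q * (((n : ℝ) + 1) / n) = r := by
    have : (n : ℝ) ≠ 0 := by linarith
    rw [hq, hr]; field_simp
  -- constants
  set X0 : ℝ := max 1 ((C * (q + 1)) ^ 20) with hX0
  have hX1 : 1 ≤ X0 := le_max_left _ _
  -- M is the level at which |u| is split below; since q < r, a large M makes the high part of
  -- (n+1)∫|u|^q at most 1/3. The constant c is chosen after M.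
  obtain ⟨M, hM1, hM⟩ : ∃ M : ℝ, 1 ≤ M ∧ ((n : ℝ) + 1) * M ^ (q - r) * X0 ≤ 1 / 3 := by
    have ht : Filter.Tendsto (fun M : ℝ => ((n : ℝ) + 1) * M ^ (q - r) * X0) Filter.atTop
        (nhds (((n : ℝ) + 1) * 0 * X0)) := by
      have := tendsto_rpow_neg_atTop (show 0 < r - q by linarith)
      rw [neg_sub] at this
      exact (this.const_mul _).mul_const _
    rw [mul_zero, zero_mul] at ht
    have h1 := ht.eventually (gt_mem_nhds (show (0 : ℝ) < 1 / 3 by norm_num))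
    obtain ⟨M, h1, h2⟩ := (h1.and (Filter.eventually_ge_atTop 1)).exists
    exact ⟨M, h2, h1.le⟩
  have hc : ∃ c : ℝ, 0 < c ∧ c ≤ 1 ∧ ((n : ℝ) + 1) * M ^ (q - 4) * c
      + q * (X0 ^ (3 / 4 : ℝ) * c ^ (1 / 4 : ℝ)) < 2 / 3 := by
    have ht : Filter.Tendsto (fun c : ℝ => ((n : ℝ) + 1) * M ^ (q - 4) * c
        + q * (X0 ^ (3 / 4 : ℝ) * c ^ (1 / 4 : ℝ))) (nhdsWithin 0 (Set.Ioi 0)) (nhds 0) := by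
      have hcont : Continuous fun c : ℝ => ((n : ℝ) + 1) * M ^ (q - 4) * c
        + q * (X0 ^ (3 / 4 : ℝ) * c ^ (1 / 4 : ℝ)) := by
        have : Continuous fun c : ℝ => c ^ (1 / 4 : ℝ) :=
          Real.continuous_rpow_const (by norm_num)
        fun_prop
      have := (hcont.tendsto 0).mono_left (nhdsWithin_le_nhds (s := Set.Ioi 0))
      simpa using this
    have h1 := ht.eventually (gt_mem_nhds (show (0 : ℝ) < 2 / 3 by norm_num))
    obtain ⟨c, ⟨h1, h2⟩, h3⟩ := ((h1.and self_mem_nhdsWithin).and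
      (mem_nhdsWithin_of_mem_nhds (gt_mem_nhds (show (0 : ℝ) < 1 by norm_num)))).exists
    exact ⟨c, h2, le_of_lt h3, h1⟩
  obtain ⟨c, hc0, hc1, hc⟩ := hc
  refine ⟨c, hc0, fun u hu hnorm => ?_⟩
  by_contra! hlt
  have cu := hu.continuous
  have hf : ContDiff ℝ 1 fun x => |u x| ^ q := hu.norm_rpow (by linarith)
  have cq := hf.continuous
  have cr : Continuous fun x => |u x| ^ r := cu.abs.rpow_const fun x => Or.inr (by linarith)
  set G := ∫ x in closedBall (0 : Euc (n + 1)) 1, ‖fderiv ℝ u x‖ ^ 4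
  set S := ∫ t : sphere (0 : Euc (n + 1)) 1, u t ^ 4 ∂surface n
  set X := ∫ x in closedBall (0 : Euc (n + 1)) 1, |u x| ^ r
  have hG0 : 0 ≤ G := integral_nonneg fun x => by positivity
  have hS0 : 0 ≤ S := integral_nonneg fun x => by positivity
  have hX0' : 0 ≤ X := integral_nonneg fun x => by positivity
  have hGc : G ≤ c := by linarith
  have hgrad := integral_fderiv_rpow_le hu (by linarith : 1 < q) hqr'
  have hG4 : G ^ (1 / 4 : ℝ) ≤ c ^ (1 / 4 : ℝ) := Real.rpow_le_rpow hG0 hGc (by norm_num)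
  have hG41 : G ^ (1 / 4 : ℝ) ≤ 1 := hG4.trans (Real.rpow_le_one hc0.le hc1 (by norm_num))
  -- the bound on the interior norm
  have hXle : X ≤ X0 := by
    rcases le_total X 1 with h | h
    · exact h.trans hX1
    have h1 := hsob _ hf
    have e1 : ∀ x : Euc (n + 1), (|u x| ^ q) ^ (((n : ℝ) + 1) / n) = |u x| ^ r := by
      intro x
      rw [← Real.rpow_mul (abs_nonneg _), hqp]
    have e2 : ∀ x : Euc (n + 1), |(|u x| ^ q)| = |u x| ^ q := fun x => abs_of_nonneg (by positivity)
    simp only [e2, e1, hnorm] at h1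
    have hX34 : 1 ≤ X ^ (3 / 4 : ℝ) := Real.one_le_rpow h (by norm_num)
    have h2 : X ^ (4 / 5 : ℝ) ≤ C * (q + 1) * X ^ (3 / 4 : ℝ) := by
      -- For n ≥ 4 the Sobolev power n/(n+1) is at least 4/5, which beats the 3/4 on the right by
      -- 1/20. This gap bounds X, and explains the exponent 20 in `X0`.
      have hexp : (4 / 5 : ℝ) ≤ (n : ℝ) / (n + 1) := by
        rw [div_le_div_iff₀ (by norm_num) (by linarith)]; linarith
      refine (Real.rpow_le_rpow_of_exponent_le h hexp).trans (h1.trans ?_)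
      rw [mul_assoc]
      refine mul_le_mul_of_nonneg_left ?_ hC.le
      have : X ^ (3 / 4 : ℝ) * G ^ (1 / 4 : ℝ) ≤ X ^ (3 / 4 : ℝ) :=
        mul_le_of_le_one_right (by positivity) hG41
      have := mul_le_mul_of_nonneg_left this (by linarith : 0 ≤ q)
      linarith
    have h3 : X ^ (1 / 20 : ℝ) ≤ C * (q + 1) := by
      have hs : X ^ (4 / 5 : ℝ) = X ^ (1 / 20 : ℝ) * X ^ (3 / 4 : ℝ) := by
        rw [← Real.rpow_add (by linarith)]; norm_num
      rw [hs] at h2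
      exact le_of_mul_le_mul_right h2 (by linarith)
    have h4 : X = (X ^ (1 / 20 : ℝ)) ^ 20 := by
      rw [← Real.rpow_natCast, ← Real.rpow_mul hX0']; norm_num
    rw [h4]
    exact (pow_le_pow_left₀ (by positivity) h3 20).trans (le_max_right _ _)
  have hX34 : X ^ (3 / 4 : ℝ) ≤ X0 ^ (3 / 4 : ℝ) := Real.rpow_le_rpow hX0' hXle (by norm_num)
  -- interpolation
  have hpt : ∀ x, |u x| ^ q ≤ M ^ (q - 4) * u x ^ 4 + M ^ (q - r) * |u x| ^ r := by
    intro x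
    have hM0 : 0 < M := by linarith
    have hu4 : u x ^ 4 = |u x| ^ (4 : ℝ) := by
      rw [← Even.pow_abs (by decide : Even 4) (u x)]; norm_cast
    rw [hu4]
    have ha := abs_nonneg (u x)
    generalize |u x| = a at *
    rcases eq_or_lt_of_le ha with h0 | h0
    · rw [← h0, Real.zero_rpow (by linarith)]; positivity
    have p1 : 0 ≤ M ^ (q - 4) * a ^ (4 : ℝ) := by positivity
    have p2 : 0 ≤ M ^ (q - r) * a ^ r := by positivity
    -- Below level M the power 4 dominates since q > 4; above it the power r does since q < r.
    rcases le_total a M with h | h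
    · have : a ^ q = a ^ (q - 4) * a ^ (4 : ℝ) := by rw [← Real.rpow_add h0]; ring_nf
      have h1 : a ^ (q - 4) ≤ M ^ (q - 4) := Real.rpow_le_rpow ha h (by linarith)
      have : a ^ q ≤ M ^ (q - 4) * a ^ (4 : ℝ) := by rw [this]; gcongr
      linarith
    · have : a ^ q = a ^ (q - r) * a ^ r := by rw [← Real.rpow_add h0]; ring_nf
      have h1 : a ^ (q - r) ≤ M ^ (q - r) := Real.rpow_le_rpow_of_nonpos hM0 h (by linarith)
      have : a ^ q ≤ M ^ (q - r) * a ^ r := by rw [this]; gcongr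
      linarith
  have hint : ∫ x in closedBall (0 : Euc (n + 1)) 1, |u x| ^ q ≤
      M ^ (q - 4) * (∫ x in closedBall (0 : Euc (n + 1)) 1, u x ^ 4) + M ^ (q - r) * X := by
    rw [← integral_const_mul, ← integral_const_mul, ← integral_add
      (integrableOn_ball (by fun_prop) 1) (integrableOn_ball (by fun_prop) 1)]
    exact setIntegral_mono_on (integrableOn_ball cq 1) (integrableOn_ball (by fun_prop) 1)
      measurableSet_closedBall fun x _ => hpt x
  have hu4 := integral_pow_four_le (by lia) hu
  have htr := integral_sphere_eq_ball hf
  rw [hnorm] at htr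
  have hab := (abs_le.1 (abs_integral_fderiv_self_le hf)).2
  have k1 : X ^ (3 / 4 : ℝ) * G ^ (1 / 4 : ℝ) ≤ X0 ^ (3 / 4 : ℝ) * c ^ (1 / 4 : ℝ) := by gcongr
  have k2 := mul_le_mul_of_nonneg_left k1 (by linarith : 0 ≤ q)
  have hMp : 0 ≤ M ^ (q - 4) := Real.rpow_nonneg (by linarith) _
  have hMr : 0 ≤ M ^ (q - r) := Real.rpow_nonneg (by linarith) _
  have k3 : ((n : ℝ) + 1) * (∫ x in closedBall (0 : Euc (n + 1)) 1, |u x| ^ q) ≤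
      ((n : ℝ) + 1) * M ^ (q - 4) * c + ((n : ℝ) + 1) * M ^ (q - r) * X0 := by
    have h1 : M ^ (q - 4) * (∫ x in closedBall (0 : Euc (n + 1)) 1, u x ^ 4) ≤ M ^ (q - 4) * c :=
      mul_le_mul_of_nonneg_left (by linarith) hMp
    have h2 : M ^ (q - r) * X ≤ M ^ (q - r) * X0 := mul_le_mul_of_nonneg_left hXle hMr
    calc _ ≤ ((n : ℝ) + 1) * (M ^ (q - 4) * c + M ^ (q - r) * X0) :=
          mul_le_mul_of_nonneg_left (by linarith) (by linarith)
      _ = _ := by ring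
  -- Unit boundary mass is bounded by (n+1)∫|u|^q + ∫|∇|u|^q|, which the choices of M and c make
  -- strictly less than 1.
  linarith

/-- A normalized positive constant is admissible, so the infimum is taken over a nonempty set. -/
lemma exists_const_mem (hn : 4 ≤ n) : ∃ u ∈ C1 n,
    ∫ t : sphere (0 : Euc (n + 1)) 1, |u t| ^ (4 * (n : ℝ) / ((n : ℝ) - 3)) ∂surface n = 1 := by
  have h4 : (4 : ℝ) ≤ n := by exact_mod_cast hn
  have h3 : (0 : ℝ) < (n : ℝ) - 3 := by linarith
  set q : ℝ := 4 * (n : ℝ) / ((n : ℝ) - 3) with hq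
  have hq0 : 0 < q := by positivity
  set A : ℝ := (surface n).real Set.univ with hA
  have hA0 : 0 < A := by
    rw [hA, measureReal_def, ENNReal.toReal_pos_iff]
    refine ⟨?_, measure_lt_top _ _⟩
    rw [Measure.measure_univ_pos]
    exact Measure.toSphere_ne_zero _
  have hc : 0 < (A⁻¹) ^ q⁻¹ := by positivity
  refine ⟨fun _ => (A⁻¹) ^ q⁻¹, ⟨contDiff_const, fun x _ => hc, fun x _ => ?_, fun x _ => ?_⟩, ?_⟩
  · simp [sigma1]
  · simp only [meanH, fderiv_fun_const, Pi.zero_apply, zero_apply, zero_add]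
    positivity
  · beta_reduce
    rw [abs_of_pos hc, ← Real.rpow_mul (by positivity), inv_mul_cancel₀ hq0.ne', Real.rpow_one,
      integral_const, smul_eq_mul, mul_inv_cancel₀ hA0.ne']

end TraceSobolev

end SobolevTrace

end

/-! ### Positivity of the infimum. -/

theorem mainTheorem3 (n : ℕ) (hn : 4 ≤ n) :
    0 < sInf (SobolevTrace.E2 n ''
      {u | u ∈ SobolevTrace.C1 n ∧
        ∫ x : sphere (0 : SobolevTrace.Euc (n + 1)) 1,
          |u x| ^ (4 * (n : ℝ) / ((n : ℝ) - 3)) ∂(SobolevTrace.surface n) = 1}) := by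
  have h4 : (4 : ℝ) ≤ n := by exact_mod_cast hn
  obtain ⟨c, hc, hS⟩ := SobolevTrace.exists_sobolev_trace hn
  obtain ⟨w, hw, hw1⟩ := SobolevTrace.exists_const_mem hn
  set K : ℝ := (((n : ℝ) - 3) / 4) ^ 3 * ((n : ℝ) + 1) / 4 with hK
  have hK0 : 0 < K := by
    have : 0 < (n : ℝ) - 3 := by linarith
    positivity
  have hm : 0 < min (1 / 2) K := lt_min (by norm_num) hK0
  -- Nonemptiness is essential, since the real infimum of the empty set is 0 by convention.
  refine (mul_pos hm hc).trans_le (le_csInf ⟨_, w, ⟨hw, hw1⟩, rfl⟩ ?_)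
  rintro _ ⟨u, ⟨hu, hu1⟩, rfl⟩
  refine le_trans ?_ (SobolevTrace.E2_ge hn hu)
  have h1 := hS u (hu.1.of_le (by simp)) hu1
  have hG : 0 ≤ ∫ x in closedBall (0 : SobolevTrace.Euc (n + 1)) 1, ‖fderiv ℝ u x‖ ^ 4 :=
    integral_nonneg fun x => by positivity
  have hT : 0 ≤ ∫ t : sphere (0 : SobolevTrace.Euc (n + 1)) 1,
      u t ^ 4 ∂SobolevTrace.surface n := integral_nonneg fun x => by positivity
  calc min (1 / 2) K * c ≤ min (1 / 2) K *
        ((∫ x in closedBall (0 : SobolevTrace.Euc (n + 1)) 1, ‖fderiv ℝ u x‖ ^ 4) +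
        ∫ t : sphere (0 : SobolevTrace.Euc (n + 1)) 1, u t ^ 4 ∂SobolevTrace.surface n) := by
        gcongr
    _ ≤ _ := by
      rw [mul_add]
      exact add_le_add (mul_le_mul_of_nonneg_right (min_le_left _ _) hG)
        (mul_le_mul_of_nonneg_right (min_le_right _ _) hT)
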